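/- **Setting.** Let $\Omega\subset\mathbb R^2$ be a bounded domain, $(\cdot,\cdot)$ and $\|\cdot\|$ the inner product and norm of $\mathbf L^2=[L^2(\Omega)]^2$ (or of $L^2(\Omega)$), $\mathbf H^1_0=[H^1_0(\Omega)]^2$, $\mathbf J_1=\{v\in\mathbf H_0^1:\nabla\cdot v=0\}$, and let $\|\cdot\|_1,\|\cdot\|_2$ be the $H^1$- and $H^2$-norms. Assume that $\Omega$ is regular for the Stokes problem: there is $C$ such that for every $g\in\mathbf L^2$ the weak solution $v\in\mathbf J_1$, $q\in L^2/\mathbb R$ of $-\Delta v+\nabla q=g$, $\nabla\cdot v=0$ satisfies $\|v\|_2+\|q\|_{H^1/\mathbb R}\le C\|g\|$. Let $\mu,\gamma,\delta,M_0,K_0,K_5>0$, $\beta(t)=\gamma e^{-\delta t}$, let $\lambda_1$ be the smallest eigenvalue of the Stokes operator, and $0<\alpha<\min\{\mu\lambda_1,\delta\}$. Put $$a(v,w)=(\nabla v,\nabla w),\qquad b(v,w,\phi)=\tfrac12(v\cdot\nabla w,\phi)-\tfrac12(v\cdot\nabla\phi,w).$$ Let $0<t_0<T\le\infty$; let $u_0\in\mathbf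 J_1$ with $\|\nabla u_0\|\le M_0$ and $f,f_t\in L^\infty(0,T;\mathbf L^2)$ with $\sup\|f\|,\sup\|f_t\|\le M_0$ ($f$ is taken continuous in time). Let $0<h<H<1$. For $k\in\{h,H\}$ let $\mathbf H_k\subset\mathbf H^1_0$ and $L_k\subset L^2(\Omega)$ be finite dimensional, $\mathbf J_k=\{v\in\mathbf H_k:(\chi,\nabla\cdot v)=0\ \ \forall\chi\in L_k\}$, and $P_k$ the $\mathbf L^2$-orthogonal projection onto $\mathbf J_k$. Assume: * for each $w\in\mathbf H_0^1\cap\mathbf H^2$ there is $i_kw\in\mathbf H_k$ with $\|w-i_kw\|+k\|\nabla(w-i_kw)\|\le K_0k^2\|w\|_2$; * for each $q\in H^1/\mathbb R$ there is $j_kq\in L_k$ with $\|q-j_kq\|_{L^2/\mathbb R}\le K_0k\|q\|_{H^1/\mathbb R}$; * $\|\nabla w\|\le K_0k^{-1}\|w\|$ for $w\in\mathbf H_k$; * for each $w\in\mathbf J_1\cap\mathbf H^2$ there is $r_kw\in\mathbf J_k$ with $\|w-r_kw\|+k\|\nabla(w-r_kw)\|\le K_5k^2\|w\|_2$. Put $\mathbf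 J_h^H=(I-P_H)\mathbf J_h$ and assume $\mathbf J_h=\mathbf J_H+\mathbf J_h^H$. Let $u_h:[0,t_0]\to\mathbf J_h$ be the Galerkin approximation: it is continuous, $u_h(0)=P_hu_0$, and for $0<t\le t_0$ and all $\phi\in\mathbf J_h$, $$(u_{h,t},\phi)+\mu a(u_h,\phi)+\int_0^t\beta(t-s)a(u_h(s),\phi)\,ds=-b(u_h,u_h,\phi)+(f,\phi).$$ Let $(y^H,z^h)$, with $y^H(t)\in\mathbf J_H$, $z^h(t)\in\mathbf J_h^H$ and $u^h=y^H+z^h$, be a solution of one of the two nonlinear Galerkin methods (NLG), that is, $y^H(t_0)=P_Hu_h(t_0)$, $y^H$ is continuous and is differentiable for $t>t_0$, $u^h$ is locally square integrable in time on $[t_0,T]$ (on $[t_0,\infty)$ if $T=\infty$), and for all $t>t_0$ ($t\le T$, $t<\infty$), all $\phi\in\mathbf J_H$ and all $\chi\in\mathbf J_h^H$, $$(y^H_t,\phi)+\mu a(u^h,\phi)+b(u^h,u^h,\phi)+\int_{t_0}^t\beta(t-s)a(u^h(s),\phi)\,ds=(f,\phi),$$ $$\mu a(u^h,\chi)+N(\chi)+\int_{t_0}^t\beta(t-s)a(u^h(s),\chi)\,ds=(f,\chi),$$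 where $N(\chi)=b(u^h,u^h,\chi)$ (NLG I) or $N(\chi)=b(u^h,y^H,\chi)+b(y^H,z^h,\chi)$ (NLG II). **Lemma 4.1.** There is a constant $K>0$ depending only on $\Omega,\mu,\gamma,\delta,\alpha,M_0,K_0,K_5$ (in particular not on $h,H,t,t_0,T$, the spaces, $u_0$, $f$ or the solutions) such that the following holds. 1. For all $t>t_0$ ($t\le T$, $t<\infty$), $s\mapsto e^{2\alpha s}\|\nabla u^h(s)\|^2$ is integrable on $(t_0,t)$ and $$\|y^H(t)\|^2+e^{-2\alpha t}\int_{t_0}^te^{2\alpha s}\|\nabla u^h(s)\|^2\,ds\le K.$$ 2. Let $H_0\in(0,1)$ and $\kappa_1,\kappa_2>0$. There is $c>0$, depending only on these numbers and on the data listed above, such that whenever $H\le H_0$ and $\kappa_1|\log H|^{1/2}\le L_H\le\kappa_2|\log h|^{1/2}$ (in particular whenever $\kappa_1|\log h|^{1/2}\le L_H\le\kappa_2|\log h|^{1/2}$, i.e. $L_H\sim|\log h|^{1/2}$), every $t>t_0$ ($t\le T$, $t<\infty$) with $$\mu-cL_H^2\|y^H(t)\|^2>0$$ satisfies $\|z^h(t)\|\le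 K$. -/

import Mathlib

open MeasureTheory Set Filter Topology
open scoped ContDiff

noncomputable section

namespace Oldroyd

/-- The plane `ℝ²` with its Euclidean norm. -/
abbrev Plane : Type := EuclideanSpace ℝ (Fin 2)

/-- A bounded domain (non-empty, open, connected) of `ℝ²`. -/
structure PlanarDomain where
  carrier : Set Plane
  isOpen : IsOpen carrier
  isConnected : IsConnected carrier
  isBounded : Bornology.IsBounded carrier

/-- Lebesgue measure on `Ω`. -/
abbrev vol (Ω : PlanarDomain) : Measure Plane := volume.restrict Ω.carrier

/-- `L²(Ω)`. -/
abbrev L2 (Ω : PlanarDomain) : Type := Lp ℝ 2 (vol Ω)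

/-- `𝐋² = [L²(Ω)]²`, with `(v, w) = ∑ i, (vᵢ, wᵢ)`. -/
abbrev VL2 (Ω : PlanarDomain) : Type := PiLp 2 (fun _ : Fin 2 => L2 Ω)

/-! ### Weak derivatives and Sobolev spaces -/

/-- Test functions `C_c^∞(Ω)`. -/
def IsTest (Ω : PlanarDomain) (φ : Plane → ℝ) : Prop :=
  ContDiff ℝ ∞ φ ∧ HasCompactSupport φ ∧ tsupport φ ⊆ Ω.carrier

/-- The classical partial derivative `∂ⱼ φ`. -/
def classicalPd (j : Fin 2) (φ : Plane → ℝ) (x : Plane) : ℝ :=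
  fderiv ℝ φ x (EuclideanSpace.single j 1)

/-- `g ∈ L²(Ω)` is the weak derivative `∂ⱼ u` of `u ∈ L²(Ω)`. -/
def HasWeakPd {Ω : PlanarDomain} (j : Fin 2) (u g : L2 Ω) : Prop :=
  ∀ φ : Plane → ℝ, IsTest Ω φ →
    ∫ x, u x * classicalPd j φ x ∂(vol Ω) = - ∫ x, g x * φ x ∂(vol Ω)

/-- `u ∈ H¹(Ω)`. -/
def MemH1 {Ω : PlanarDomain} (u : L2 Ω) : Prop := ∀ j : Fin 2, ∃ g : L2 Ω, HasWeakPd j u g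

open Classical in
/-- The weak derivative `∂ⱼ u` of `u ∈ H¹(Ω)` (only used for such `u`; unique by
`HasWeakPd.unique` below). -/
def pd {Ω : PlanarDomain} (j : Fin 2) (u : L2 Ω) : L2 Ω :=
  if h : ∃ g : L2 Ω, HasWeakPd j u g then h.choose else 0

theorem integrable_mul_test {Ω : PlanarDomain} (u : L2 Ω) {ψ : Plane → ℝ}
    (hc : Continuous ψ) (hs : HasCompactSupport ψ) :
    Integrable (fun x => u x * ψ x) (vol Ω) :=
  MemLp.integrable_mul (p := 2) (q := 2) (Lp.memLp u) (hc.memLp_of_hasCompactSupport hs)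

theorem integrable_mul_classicalPd {Ω : PlanarDomain} (u : L2 Ω) (j : Fin 2) {φ : Plane → ℝ}
    (hφ : IsTest Ω φ) : Integrable (fun x => u x * classicalPd j φ x) (vol Ω) := by
  refine integrable_mul_test u ?_ ?_
  · exact (hφ.1.continuous_fderiv (by simp)).clm_apply continuous_const
  · exact hφ.2.1.fderiv_apply (𝕜 := ℝ) (EuclideanSpace.single j 1)

theorem HasWeakPd.unique {Ω : PlanarDomain} {j : Fin 2} {u g g' : L2 Ω}
    (h : HasWeakPd j u g) (h' : HasWeakPd j u g') : g = g' := by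
  have key : ∀ᵐ x ∂(vol Ω), x ∈ Ω.carrier → (g - g' : L2 Ω) x = 0 := by
    refine Ω.isOpen.ae_eq_zero_of_integral_contDiff_smul_eq_zero ?_ ?_
    · exact ((Lp.memLp (g - g')).locallyIntegrable (by norm_num)).locallyIntegrableOn _
    · intro φ h1 h2 h3
      have e := h φ ⟨h1, h2, h3⟩
      have e' := h' φ ⟨h1, h2, h3⟩
      have hi : ∫ x, φ x • (g - g' : L2 Ω) x ∂(vol Ω)
          = ∫ x, (g x * φ x - g' x * φ x) ∂(vol Ω) := by
        refine integral_congr_ae ?_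
        filter_upwards [Lp.coeFn_sub g g'] with x hx
        rw [hx, Pi.sub_apply, smul_eq_mul]
        ring
      rw [hi, integral_sub (integrable_mul_test g h1.continuous h2)
        (integrable_mul_test g' h1.continuous h2)]
      linarith
  have hmem : ∀ᵐ x ∂(vol Ω), x ∈ Ω.carrier := ae_restrict_mem Ω.isOpen.measurableSet
  rw [← sub_eq_zero]
  refine Lp.ext ?_
  filter_upwards [key, hmem, Lp.coeFn_zero ℝ 2 (vol Ω)] with x hx hx' h0
  rw [hx hx', h0, Pi.zero_apply]

theorem MemH1.hasWeakPd {Ω : PlanarDomain} {u : L2 Ω} (hu : MemH1 u) (j : Fin 2) :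
    HasWeakPd j u (pd j u) := by
  unfold pd
  rw [dif_pos (hu j)]
  exact (hu j).choose_spec

theorem HasWeakPd.pd_eq {Ω : PlanarDomain} {j : Fin 2} {u g : L2 Ω} (h : HasWeakPd j u g) :
    pd j u = g := by
  have hex : ∃ g : L2 Ω, HasWeakPd j u g := ⟨g, h⟩
  unfold pd
  rw [dif_pos hex]
  exact hex.choose_spec.unique h

theorem HasWeakPd.zero {Ω : PlanarDomain} (j : Fin 2) : HasWeakPd j (0 : L2 Ω) 0 := by
  intro φ _
  have e : ∀ ψ : Plane → ℝ, ∫ x, (0 : L2 Ω) x * ψ x ∂(vol Ω) = 0 := by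
    intro ψ
    refine integral_eq_zero_of_ae ?_
    filter_upwards [Lp.coeFn_zero ℝ 2 (vol Ω)] with x hx
    rw [hx]
    simp
  rw [e, e, neg_zero]

theorem HasWeakPd.add {Ω : PlanarDomain} {j : Fin 2} {u g u' g' : L2 Ω}
    (h : HasWeakPd j u g) (h' : HasWeakPd j u' g') : HasWeakPd j (u + u') (g + g') := by
  intro φ hφ
  have e1 : ∫ x, (u + u' : L2 Ω) x * classicalPd j φ x ∂(vol Ω)
      = ∫ x, (u x * classicalPd j φ x + u' x * classicalPd j φ x) ∂(vol Ω) := by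
    refine integral_congr_ae ?_
    filter_upwards [Lp.coeFn_add u u'] with x hx
    rw [hx, Pi.add_apply, add_mul]
  have e2 : ∫ x, (g + g' : L2 Ω) x * φ x ∂(vol Ω)
      = ∫ x, (g x * φ x + g' x * φ x) ∂(vol Ω) := by
    refine integral_congr_ae ?_
    filter_upwards [Lp.coeFn_add g g'] with x hx
    rw [hx, Pi.add_apply, add_mul]
  rw [e1, e2, integral_add (integrable_mul_classicalPd u j hφ) (integrable_mul_classicalPd u' j hφ),
    integral_add (integrable_mul_test g hφ.1.continuous hφ.2.1)
      (integrable_mul_test g' hφ.1.continuous hφ.2.1), h φ hφ, h' φ hφ]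
  ring

theorem HasWeakPd.smul {Ω : PlanarDomain} {j : Fin 2} {u g : L2 Ω} (c : ℝ)
    (h : HasWeakPd j u g) : HasWeakPd j (c • u) (c • g) := by
  intro φ hφ
  have e : ∀ (v : L2 Ω) (ψ : Plane → ℝ), ∫ x, (c • v : L2 Ω) x * ψ x ∂(vol Ω)
      = c * ∫ x, v x * ψ x ∂(vol Ω) := by
    intro v ψ
    rw [← integral_const_mul]
    refine integral_congr_ae ?_
    filter_upwards [Lp.coeFn_smul c v] with x hx
    rw [hx, Pi.smul_apply, smul_eq_mul, mul_assoc]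
  rw [e, e, h φ hφ]
  ring

/-- `u ∈ H²(Ω)`. -/
def MemH2 {Ω : PlanarDomain} (u : L2 Ω) : Prop := MemH1 u ∧ ∀ j, MemH1 (pd j u)

/-- `u ∈ H¹₀(Ω)`: the closure of `C_c^∞(Ω)` in `H¹(Ω)`. -/
def MemH10 {Ω : PlanarDomain} (u : L2 Ω) : Prop :=
  MemH1 u ∧ ∃ φ : ℕ → Plane → ℝ, (∀ n, IsTest Ω (φ n)) ∧
    Tendsto (fun n => eLpNorm (fun x => u x - φ n x) 2 (vol Ω)) atTop (𝓝 0) ∧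
    ∀ j, Tendsto (fun n => eLpNorm (fun x => pd j u x - classicalPd j (φ n) x) 2 (vol Ω))
      atTop (𝓝 0)

/-- The norm of `H¹(Ω)`. -/
def normH1 {Ω : PlanarDomain} (q : L2 Ω) : ℝ := √(‖q‖ ^ 2 + ∑ j, ‖pd j q‖ ^ 2)

/-- `v ∈ 𝐇¹₀ = [H¹₀(Ω)]²`. -/
def VMemH10 {Ω : PlanarDomain} (v : VL2 Ω) : Prop := ∀ i, MemH10 (v i)

/-- `v ∈ 𝐇² = [H²(Ω)]²`. -/
def VMemH2 {Ω : PlanarDomain} (v : VL2 Ω) : Prop := ∀ i, MemH2 (v i)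

/-- The norm `‖v‖₂` of `𝐇²`. -/
def normH2 {Ω : PlanarDomain} (v : VL2 Ω) : ℝ :=
  √(∑ i, (‖v i‖ ^ 2 + ∑ j, ‖pd j (v i)‖ ^ 2 + ∑ j, ∑ k, ‖pd k (pd j (v i))‖ ^ 2))

/-- `∇ · v`. -/
def divergence {Ω : PlanarDomain} (v : VL2 Ω) : L2 Ω := ∑ i, pd i (v i)

/-- `a(v, w) = (∇v, ∇w) = ∑ᵢⱼ (∂ⱼ vᵢ, ∂ⱼ wᵢ)`. -/
def a {Ω : PlanarDomain} (v w : VL2 Ω) : ℝ := ∑ i, ∑ j, inner ℝ (pd j (v i)) (pd j (w i))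

/-- `‖∇v‖ = (∑ᵢⱼ ‖∂ⱼ vᵢ‖²)^{1/2}`. -/
def gradNorm {Ω : PlanarDomain} (v : VL2 Ω) : ℝ := √(∑ i, ∑ j, ‖pd j (v i)‖ ^ 2)

/-- `(v · ∇w, φ) = ∑ᵢⱼ ∫_Ω vⱼ (∂ⱼ wᵢ) φᵢ dx`. -/
def conv {Ω : PlanarDomain} (v w φ : VL2 Ω) : ℝ :=
  ∑ i, ∑ j, ∫ x, v j x * pd j (w i) x * φ i x ∂(vol Ω)

/-- The antisymmetrized trilinear form `b`. -/
def b {Ω : PlanarDomain} (v w φ : VL2 Ω) : ℝ := conv v w φ / 2 - conv v φ w / 2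

/-- `v ∈ 𝐉₁ = {v ∈ 𝐇¹₀ : ∇ · v = 0}`. -/
def MemJ1 {Ω : PlanarDomain} (v : VL2 Ω) : Prop := VMemH10 v ∧ divergence v = 0

/-- `ev` is an eigenvalue of the Stokes operator (in its weak form). -/
def IsStokesEigenvalue (Ω : PlanarDomain) (ev : ℝ) : Prop :=
  ∃ v : VL2 Ω, MemJ1 v ∧ v ≠ 0 ∧ ∀ w : VL2 Ω, MemJ1 w → a v w = ev * inner ℝ v w

/-- Regularity of the steady Stokes problem `-Δv + ∇q = g`, `∇ · v = 0`, `v = 0` on `∂Ω` on the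
domain `Ω`: for each `g ∈ 𝐋²` the weak solution satisfies `‖v‖₂ + ‖q‖_{H¹/ℝ} ≤ C ‖g‖`.
The velocity is determined by the equations and `q` up to a constant; the `q` below is a
representative of its class in `H¹/ℝ`. -/
def StokesRegular (Ω : PlanarDomain) : Prop :=
  ∃ C : ℝ, ∀ g : VL2 Ω, ∃ (v : VL2 Ω) (q : L2 Ω),
    MemJ1 v ∧ (∀ w : VL2 Ω, VMemH10 w → a v w - inner ℝ q (divergence w) = inner ℝ g w) ∧
    VMemH2 v ∧ MemH1 q ∧ normH2 v + normH1 q ≤ C * ‖g‖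

/-! ### Finite element spaces -/

/-- A pair of finite dimensional spaces `(𝐇_h, L_h)`, `𝐇_h ⊆ 𝐇¹₀`, `L_h ⊆ L²`. -/
structure FEPair (Ω : PlanarDomain) where
  velocity : Submodule ℝ (VL2 Ω)
  pressure : Submodule ℝ (L2 Ω)
  finiteVelocity : FiniteDimensional ℝ velocity
  finitePressure : FiniteDimensional ℝ pressure
  velocity_mem : ∀ v ∈ velocity, VMemH10 v

namespace FEPair

variable {Ω : PlanarDomain}

/-- `𝐉_h = {v ∈ 𝐇_h : (χ, ∇ · v) = 0 for all χ ∈ L_h}`. -/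
def J (S : FEPair Ω) : Submodule ℝ (VL2 Ω) where
  carrier := {v | v ∈ S.velocity ∧ ∀ χ ∈ S.pressure, inner ℝ χ (divergence v) = 0}
  zero_mem' := by
    refine ⟨S.velocity.zero_mem, fun χ _ => ?_⟩
    have e : divergence (0 : VL2 Ω) = 0 := by
      unfold divergence
      refine Finset.sum_eq_zero fun i _ => ?_
      exact (HasWeakPd.zero i).pd_eq
    rw [e, inner_zero_right]
  add_mem' := by
    rintro v w ⟨hv, hv'⟩ ⟨hw, hw'⟩
    refine ⟨S.velocity.add_mem hv hw, fun χ hχ => ?_⟩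
    have e : divergence (v + w) = divergence v + divergence w := by
      unfold divergence
      rw [← Finset.sum_add_distrib]
      refine Finset.sum_congr rfl fun i _ => ?_
      exact (((S.velocity_mem v hv i).1.hasWeakPd i).add
        ((S.velocity_mem w hw i).1.hasWeakPd i)).pd_eq
    rw [e, inner_add_right, hv' χ hχ, hw' χ hχ, add_zero]
  smul_mem' := by
    rintro c v ⟨hv, hv'⟩
    refine ⟨S.velocity.smul_mem c hv, fun χ hχ => ?_⟩
    have e : divergence (c • v) = c • divergence v := by
      unfold divergence
      rw [Finset.smul_sum]
      refine Finset.sum_congr rfl fun i _ => ?_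
      exact (((S.velocity_mem v hv i).1.hasWeakPd i).smul c).pd_eq
    rw [e, inner_smul_right, hv' χ hχ, mul_zero]

instance finiteDimensional_J (S : FEPair Ω) : FiniteDimensional ℝ S.J := by
  have := S.finiteVelocity
  exact Submodule.finiteDimensional_of_le (fun _ hv => hv.1 : S.J ≤ S.velocity)

/-- The `L²` projection `P_h : 𝐋² → 𝐉_h`. -/
def P (S : FEPair Ω) : VL2 Ω →L[ℝ] VL2 Ω := S.J.starProjection

/-- Approximation and inverse properties, with mesh parameter `h` and constants `K₀`, `K₅`:
for every `w ∈ 𝐇¹₀ ∩ 𝐇²` there is `i_h w ∈ 𝐇_h` with `‖w - i_h w‖ + h ‖∇(w - i_h w)‖ ≤ K₀ h² ‖w‖₂`;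
for every `q ∈ H¹/ℝ` there is `j_h q ∈ L_h` with `‖q - j_h q‖ ≤ K₀ h ‖q‖₁` (norms modulo constants);
`‖∇w‖ ≤ K₀ h⁻¹ ‖w‖` on `𝐇_h`; for every `w ∈ 𝐉₁ ∩ 𝐇²` there is `r_h w ∈ 𝐉_h` with
`‖w - r_h w‖ + h ‖∇(w - r_h w)‖ ≤ K₅ h² ‖w‖₂`. -/
structure Approximates (S : FEPair Ω) (h K₀ K₅ : ℝ) : Prop where
  velocity_approx : ∀ w : VL2 Ω, VMemH10 w → VMemH2 w →
    ∃ wh ∈ S.velocity, ‖w - wh‖ + h * gradNorm (w - wh) ≤ K₀ * h ^ 2 * normH2 w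
  pressure_approx : ∀ q : L2 Ω, MemH1 q →
    ∃ qh ∈ S.pressure, ∃ r : ℝ,
      eLpNorm (fun x => q x - qh x - r) 2 (vol Ω) ≤ ENNReal.ofReal (K₀ * h * normH1 q)
  inverse : ∀ w ∈ S.velocity, gradNorm w ≤ K₀ * h⁻¹ * ‖w‖
  divfree_approx : ∀ w : VL2 Ω, MemJ1 w → VMemH2 w →
    ∃ wh ∈ S.J, ‖w - wh‖ + h * gradNorm (w - wh) ≤ K₅ * h ^ 2 * normH2 w

/-- `𝐉_h^H = (I - P_H) 𝐉_h`, for the fine pair `S` and the coarse pair `SH`. -/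
def fineComplement (S SH : FEPair Ω) : Submodule ℝ (VL2 Ω) :=
  S.J.map ((ContinuousLinearMap.id ℝ (VL2 Ω) - SH.P : VL2 Ω →L[ℝ] VL2 Ω) : VL2 Ω →ₗ[ℝ] VL2 Ω)

end FEPair

/-! ### The schemes -/

/-- The memory kernel `β(t) = γ exp(-δ t)`. -/
def kernel (γ δ t : ℝ) : ℝ := γ * Real.exp (-δ * t)

/-- The time interval `[t₀, T]`, which is `[t₀, ∞)` for `T = ∞`. -/
def timeSet (t₀ : ℝ) (T : EReal) : Set ℝ := {t | t₀ ≤ t ∧ (t : EReal) ≤ T}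

/-- `f, f_t ∈ L^∞(0, T; 𝐋²)` with `sup ‖f‖, sup ‖f_t‖ ≤ M₀`; `f` is the representative that is
continuous in time and `f'` is the (weak) time derivative `f_t`. -/
def BoundedForce {Ω : PlanarDomain} (f : ℝ → VL2 Ω) (M₀ : ℝ) (T : EReal) : Prop :=
  (∀ t ∈ timeSet 0 T, 0 < t → ‖f t‖ ≤ M₀) ∧
  ∃ f' : ℝ → VL2 Ω, AEStronglyMeasurable f' (volume.restrict (timeSet 0 T)) ∧
    (∀ᵐ t ∂(volume.restrict (timeSet 0 T)), ‖f' t‖ ≤ M₀) ∧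
    ∀ s ∈ timeSet 0 T, ∀ t ∈ timeSet 0 T, 0 < s → s ≤ t → f t - f s = ∫ r in s..t, f' r

/-- The classical (semi-discrete) Galerkin approximation `u_h` on `[0, t₀]`:
`u_h(0) = P_h u₀` and, for `0 < t ≤ t₀` and `φ ∈ 𝐉_h`,
`(u_{h,t}, φ) + μ a(u_h, φ) + ∫₀ᵗ β(t-s) a(u_h(s), φ) ds = -b(u_h, u_h, φ) + (f, φ)`. -/
structure IsGalerkin {Ω : PlanarDomain} (S : FEPair Ω) (μ γ δ : ℝ) (f : ℝ → VL2 Ω) (u₀ : VL2 Ω)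
    (t₀ : ℝ) (uh : ℝ → VL2 Ω) : Prop where
  mem : ∀ t ∈ Icc 0 t₀, uh t ∈ S.J
  continuousOn : ContinuousOn uh (Icc 0 t₀)
  init : uh 0 = S.P u₀
  equation : ∀ t ∈ Ioc 0 t₀, ∃ ut : VL2 Ω, HasDerivWithinAt uh ut (Icc 0 t₀) t ∧
    ∀ φ ∈ S.J, inner ℝ ut φ + μ * a (uh t) φ + ∫ s in (0 : ℝ)..t, kernel γ δ (t - s) * a (uh s) φ
      = - b (uh t) (uh t) φ + inner ℝ (f t) φ

/-- The nonlinear term of the fine-grid equation of the first method, `b(u^h, u^h, χ)`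
with `u^h = y + z`. -/
def fineTermI {Ω : PlanarDomain} (y z χ : VL2 Ω) : ℝ := b (y + z) (y + z) χ

/-- The nonlinear term of the fine-grid equation of the second method,
`b(u^h, y, χ) + b(y, z, χ)` with `u^h = y + z`. -/
def fineTermII {Ω : PlanarDomain} (y z χ : VL2 Ω) : ℝ := b (y + z) y χ + b y z χ

/-- `(y, z) = (y^H, z^h)` solves the nonlinear Galerkin system on `(t₀, T]` (on `(t₀, ∞)` if
`T = ∞`) with `u^h = y + z`, started from `y(t₀) = P_H u_h(t₀)`; `N` is the nonlinear term of the
fine-grid equation. The function `y` is continuous and has a time derivative for `t > t₀`, and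
`u^h` is locally square integrable in time (so that the memory term is defined). -/
structure IsNLG {Ω : PlanarDomain} (N : VL2 Ω → VL2 Ω → VL2 Ω → ℝ) (S SH : FEPair Ω)
    (μ γ δ : ℝ) (f : ℝ → VL2 Ω) (t₀ : ℝ) (T : EReal) (uh y z : ℝ → VL2 Ω) : Prop where
  mem_coarse : ∀ t ∈ timeSet t₀ T, y t ∈ SH.J
  mem_fine : ∀ t ∈ timeSet t₀ T, t₀ < t → z t ∈ S.fineComplement SH
  continuousOn : ContinuousOn y (timeSet t₀ T)
  square_integrable : ∀ t ∈ timeSet t₀ T,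
    MemLp (fun s => y s + z s) 2 (volume.restrict (Ioc t₀ t))
  init : y t₀ = SH.P (uh t₀)
  coarse_equation : ∀ t ∈ timeSet t₀ T, t₀ < t →
    ∃ yt : VL2 Ω, HasDerivWithinAt y yt (timeSet t₀ T) t ∧
      ∀ φ ∈ SH.J, inner ℝ yt φ + μ * a (y t + z t) φ + b (y t + z t) (y t + z t) φ
        + ∫ s in t₀..t, kernel γ δ (t - s) * a (y s + z s) φ = inner ℝ (f t) φ
  fine_equation : ∀ t ∈ timeSet t₀ T, t₀ < t → ∀ χ ∈ S.fineComplement SH,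
    μ * a (y t + z t) χ + N (y t) (z t) χ
      + ∫ s in t₀..t, kernel γ δ (t - s) * a (y s + z s) χ = inner ℝ (f t) χ

end Oldroyd

end

open Oldroyd

/-!
Write `u = y + z`. Testing the coarse equation with `y` and the fine equation with `z` makes the
trilinear terms cancel, in either method, and gives an energy inequality for `y` alone, dissipated
by `‖∇u‖²`. The exponentially weighted memory term is positive definite, because the weighted
kernel is again a decaying exponential; so the weighted inequality can be integrated in time without
a Gronwall argument, which bounds `‖y‖` and the weighted integral of `‖∇u‖²`, and the latter bounds
the memory term pointwise. For the fine scale, duality with the regular Stokes problem gives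
`‖z‖ ≤ Λ H ‖∇z‖`. With the Ladyzhenskaya and inverse inequalities, the nonlinear term of the fine
equation tested with `z` is then absorbed by `μ ‖∇z‖²` as soon as `‖y‖` is small, and the factor `H`
compensates the `H⁻¹` of the remaining coarse terms. The condition on `L_H` enforces this smallness,
as `|log H|` is bounded below.
-/

namespace Oldroyd

/-! ### The memory term -/

section Memory

variable {E : Type*} [NormedAddCommGroup E]

theorem absolutelyContinuousOnInterval_norm_integral [NormedSpace ℝ E] {V : ℝ → E} {t₀ t₁ : ℝ}
    (hV : IntervalIntegrable V volume t₀ t₁) :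
    AbsolutelyContinuousOnInterval (fun r => ‖∫ s in t₀..r, V s‖) t₀ t₁ := by
  have hn := hV.norm.absolutelyContinuousOnInterval_intervalIntegral (c := t₀) (by simp)
  rw [absolutelyContinuousOnInterval_iff] at hn ⊢
  intro ε hε
  obtain ⟨η, hη, h⟩ := hn ε hε
  refine ⟨η, hη, fun I hI hlt => lt_of_le_of_lt (Finset.sum_le_sum fun i hi => ?_) (h I hI hlt)⟩
  obtain ⟨hi₁, hi₂⟩ := hI.1 i hi
  have hint : ∀ {x}, x ∈ uIcc t₀ t₁ → IntervalIntegrable V volume t₀ x := fun hx =>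
    hV.mono_set (uIcc_subset_uIcc left_mem_uIcc hx)
  refine (dist_norm_norm_le _ _).trans ?_
  rw [Real.dist_eq, intervalIntegral.integral_interval_sub_left (hint hi₁) (hint hi₂),
    intervalIntegral.integral_interval_sub_left (hint hi₁).norm (hint hi₂).norm]
  exact intervalIntegral.norm_integral_le_abs_integral_norm

section Primitive

variable [InnerProductSpace ℝ E] {V : ℝ → E} {t₀ t₁ : ℝ}

theorem intervalIntegrable_exp_mul_inner_primitive (c : ℝ)
    (hV : IntervalIntegrable V volume t₀ t₁) :
    IntervalIntegrable (fun r => Real.exp (c * r) * inner ℝ (∫ s in t₀..r, V s) (V r))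
      volume t₀ t₁ := by
  have hFc : ContinuousOn (fun r => ∫ s in t₀..r, V s) (uIcc t₀ t₁) :=
    intervalIntegral.continuousOn_primitive_interval' hV left_mem_uIcc
  obtain ⟨C, hC⟩ := isCompact_uIcc.exists_bound_of_continuousOn hFc
  refine IntervalIntegrable.continuousOn_mul ?_ (by fun_prop)
  refine (hV.norm.const_mul C).mono_fun' ?_ ?_
  · exact ((hFc.mono uIoc_subset_uIcc).aestronglyMeasurable measurableSet_uIoc).inner
      hV.aestronglyMeasurable_restrict_uIoc
  · filter_upwards [ae_restrict_mem measurableSet_uIoc] with r hr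
    refine (norm_inner_le_norm _ _).trans ?_
    gcongr
    exact hC r (uIoc_subset_uIcc hr)

theorem two_mul_integral_exp_mul_inner_primitive [CompleteSpace E] (c : ℝ)
    (hV : IntervalIntegrable V volume t₀ t₁) :
    2 * ∫ r in t₀..t₁, Real.exp (c * r) * inner ℝ (∫ s in t₀..r, V s) (V r) =
      Real.exp (c * t₁) * ‖∫ s in t₀..t₁, V s‖ ^ 2
        - c * ∫ r in t₀..t₁, Real.exp (c * r) * ‖∫ s in t₀..r, V s‖ ^ 2 := by
  have hFc : ContinuousOn (fun r => ∫ s in t₀..r, V s) (uIcc t₀ t₁) :=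
    intervalIntegral.continuousOn_primitive_interval' hV left_mem_uIcc
  have hn := absolutelyContinuousOnInterval_norm_integral hV
  have hexp : AbsolutelyContinuousOnInterval (fun r => Real.exp (c * r)) t₀ t₁ :=
    ContDiffOn.absolutelyContinuousOnInterval (by fun_prop)
  have hderiv : ∀ᵐ r, r ∈ uIoc t₀ t₁ →
      deriv (fun x => Real.exp (c * x) * (‖∫ s in t₀..x, V s‖ * ‖∫ s in t₀..x, V s‖)) r =
        2 * (Real.exp (c * r) * inner ℝ (∫ s in t₀..r, V s) (V r))
          + c * (Real.exp (c * r) * ‖∫ s in t₀..r, V s‖ ^ 2) := by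
    filter_upwards [hV.ae_hasDerivAt_integral] with r hr hrm
    have hsq := (hr (uIoc_subset_uIcc hrm) t₀ left_mem_uIcc).norm_sq
    have hexp' : HasDerivAt (fun x => Real.exp (c * x)) (Real.exp (c * r) * c) r := by
      simpa using ((hasDerivAt_id r).const_mul c).exp
    simp only [← sq]
    rw [(hexp'.fun_mul hsq).deriv]
    ring
  have hftc := (hexp.fun_mul (hn.fun_mul hn)).integral_deriv_eq_sub
  have hF : IntervalIntegrable (fun r => Real.exp (c * r) * ‖∫ s in t₀..r, V s‖ ^ 2)
      volume t₀ t₁ := ContinuousOn.intervalIntegrable (by fun_prop)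
  rw [intervalIntegral.integral_congr_ae hderiv, intervalIntegral.integral_add
      ((intervalIntegrable_exp_mul_inner_primitive c hV).const_mul 2) (hF.const_mul c),
    intervalIntegral.integral_const_mul, intervalIntegral.integral_const_mul,
    intervalIntegral.integral_same, norm_zero] at hftc
  linarith

theorem integral_exp_mul_inner_primitive_nonneg [CompleteSpace E] {c : ℝ} (hc : c ≤ 0)
    (h01 : t₀ ≤ t₁) (hV : IntervalIntegrable V volume t₀ t₁) :
    0 ≤ ∫ r in t₀..t₁, Real.exp (c * r) * inner ℝ (∫ s in t₀..r, V s) (V r) := by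
  have hF : 0 ≤ ∫ r in t₀..t₁, Real.exp (c * r) * ‖∫ s in t₀..r, V s‖ ^ 2 :=
    intervalIntegral.integral_nonneg h01 fun r _ => by positivity
  have hend : 0 ≤ Real.exp (c * t₁) * ‖∫ s in t₀..t₁, V s‖ ^ 2 := by positivity
  linarith [two_mul_integral_exp_mul_inner_primitive c hV, mul_nonpos_of_nonpos_of_nonneg hc hF]

end Primitive

/-- The Volterra memory term `∫_{t₀}^t β(t - s) U(s) ds`, with `β` the exponential `kernel`, of a
function `U` with values in a normed space. -/
noncomputable def memory [NormedSpace ℝ E] (γ δ t₀ : ℝ) (U : ℝ → E) (t : ℝ) : E :=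
  ∫ s in t₀..t, kernel γ δ (t - s) • U s

theorem memory_eq_smul_integral [NormedSpace ℝ E] (γ δ t₀ : ℝ) (U : ℝ → E) (t : ℝ) :
    memory γ δ t₀ U t = (γ * Real.exp (-δ * t)) • ∫ s in t₀..t, Real.exp (δ * s) • U s := by
  rw [memory, ← intervalIntegral.integral_smul]
  refine intervalIntegral.integral_congr fun s _ => ?_
  simp only [kernel, smul_smul, mul_assoc, ← Real.exp_add]
  ring_nf

theorem inner_memory [InnerProductSpace ℝ E] [CompleteSpace E] (γ δ : ℝ) {U : ℝ → E} {t₀ t : ℝ}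
    (hU : IntervalIntegrable U volume t₀ t) (e : E) :
    inner ℝ (memory γ δ t₀ U t) e = ∫ s in t₀..t, kernel γ δ (t - s) * inner ℝ (U s) e := by
  have hkU : IntervalIntegrable (fun s => kernel γ δ (t - s) • U s) volume t₀ t :=
    hU.continuousOn_smul (by unfold kernel; fun_prop)
  rw [real_inner_comm, memory, ← innerSL_apply_apply ℝ e,
    ← ContinuousLinearMap.intervalIntegral_comp_comm _ hkU]
  simp only [innerSL_apply_apply, inner_smul_right, real_inner_comm e]

section Positivity

variable [InnerProductSpace ℝ E] {U : ℝ → E} {γ δ α t₀ t₁ : ℝ}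

theorem exp_mul_inner_memory (γ δ α t₀ : ℝ) (U : ℝ → E) (t : ℝ) :
    Real.exp (2 * α * t) * inner ℝ (memory γ δ t₀ U t) (U t) =
      γ * (Real.exp (2 * (α - δ) * t) *
        inner ℝ (∫ s in t₀..t, Real.exp (δ * s) • U s) (Real.exp (δ * t) • U t)) := by
  have hexp : Real.exp (2 * α * t) * Real.exp (-δ * t)
      = Real.exp (2 * (α - δ) * t) * Real.exp (δ * t) := by
    simp only [← Real.exp_add]
    ring_nf
  rw [memory_eq_smul_integral, real_inner_smul_left, real_inner_smul_right]
  linear_combination (γ * inner ℝ (∫ s in t₀..t, Real.exp (δ * s) • U s) (U t)) * hexp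

theorem intervalIntegrable_exp_mul_inner_memory (γ δ α : ℝ)
    (hU : IntervalIntegrable U volume t₀ t₁) :
    IntervalIntegrable (fun t => Real.exp (2 * α * t) * inner ℝ (memory γ δ t₀ U t) (U t))
      volume t₀ t₁ := by
  simp only [exp_mul_inner_memory]
  exact (intervalIntegrable_exp_mul_inner_primitive _
    (hU.continuousOn_smul (by fun_prop))).const_mul γ

theorem integral_exp_mul_inner_memory_nonneg [CompleteSpace E] (hγ : 0 ≤ γ) (hα : α ≤ δ)
    (h01 : t₀ ≤ t₁) (hU : IntervalIntegrable U volume t₀ t₁) :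
    0 ≤ ∫ t in t₀..t₁, Real.exp (2 * α * t) * inner ℝ (memory γ δ t₀ U t) (U t) := by
  simp only [exp_mul_inner_memory, intervalIntegral.integral_const_mul]
  exact mul_nonneg hγ (integral_exp_mul_inner_primitive_nonneg (by linarith) h01
    (hU.continuousOn_smul (by fun_prop)))

end Positivity

end Memory

theorem integral_exp_two_mul {α : ℝ} (hα : α ≠ 0) (t₀ t₁ : ℝ) :
    ∫ s in t₀..t₁, Real.exp (2 * α * s)
      = (Real.exp (2 * α * t₁) - Real.exp (2 * α * t₀)) / (2 * α) := by
  rw [intervalIntegral.integral_comp_mul_left _ (by simpa using hα), integral_exp, smul_eq_mul]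
  field_simp

theorem norm_kernel_smul_le {E : Type*} [SeminormedAddCommGroup E] [NormedSpace ℝ E] {γ : ℝ}
    (hγ : 0 ≤ γ) (δ α t s : ℝ) (e : E) :
    ‖kernel γ δ (t - s) • e‖ ≤
      γ / 2 * (Real.exp (-2 * (δ - α) * t) * Real.exp (2 * (δ - α) * s)
        + Real.exp (-2 * α * t) * (Real.exp (2 * α * s) * ‖e‖ ^ 2)) := by
  have hδ : Real.exp (-δ * (t - s))
      = Real.exp (-(δ - α) * (t - s)) * Real.exp (-α * (t - s)) := by
    rw [← Real.exp_add]
    ring_nf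
  have hδα : Real.exp (-2 * (δ - α) * t) * Real.exp (2 * (δ - α) * s)
      = Real.exp (-(δ - α) * (t - s)) ^ 2 := by
    rw [← Real.exp_add, ← Real.exp_nat_mul]
    ring_nf
  have hα : Real.exp (-2 * α * t) * Real.exp (2 * α * s) = Real.exp (-α * (t - s)) ^ 2 := by
    rw [← Real.exp_add, ← Real.exp_nat_mul]
    ring_nf
  calc ‖kernel γ δ (t - s) • e‖
      = γ / 2 * (2 * Real.exp (-(δ - α) * (t - s)) * (Real.exp (-α * (t - s)) * ‖e‖)) := by
        rw [norm_smul, kernel, norm_mul, Real.norm_of_nonneg hγ,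
          Real.norm_of_nonneg (by positivity), hδ]
        ring
    _ ≤ γ / 2 * (Real.exp (-(δ - α) * (t - s)) ^ 2 + (Real.exp (-α * (t - s)) * ‖e‖) ^ 2) := by
        gcongr
        exact two_mul_le_add_sq _ _
    _ = _ := by rw [hδα, ← mul_assoc, hα, mul_pow]

theorem norm_memory_le {E : Type*} [NormedAddCommGroup E] [NormedSpace ℝ E] {γ δ α t₀ t R : ℝ}
    {U : ℝ → E} (hγ : 0 ≤ γ) (hα : α < δ) (ht : t₀ ≤ t)
    (hU : IntervalIntegrable (fun s => Real.exp (2 * α * s) * ‖U s‖ ^ 2) volume t₀ t)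
    (hR : Real.exp (-2 * α * t) * ∫ s in t₀..t, Real.exp (2 * α * s) * ‖U s‖ ^ 2 ≤ R) :
    ‖memory γ δ t₀ U t‖ ≤ γ / 2 * (1 / (2 * (δ - α)) + R) := by
  have hδα : 0 < δ - α := sub_pos.2 hα
  have hexp : IntervalIntegrable (fun s => Real.exp (2 * (δ - α) * s)) volume t₀ t :=
    Continuous.intervalIntegrable (by fun_prop) _ _
  have hfading : Real.exp (-2 * (δ - α) * t) * ∫ s in t₀..t, Real.exp (2 * (δ - α) * s)
      ≤ 1 / (2 * (δ - α)) := by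
    rw [integral_exp_two_mul hδα.ne', ← mul_div_assoc]
    gcongr
    rw [mul_sub, ← Real.exp_add, show -2 * (δ - α) * t + 2 * (δ - α) * t = 0 by ring,
      Real.exp_zero]
    exact sub_le_self _ (by positivity)
  refine (intervalIntegral.norm_integral_le_of_norm_le ht
    (.of_forall fun s _ => norm_kernel_smul_le hγ δ α t s (U s))
    (((hexp.const_mul _).add (hU.const_mul _)).const_mul _)).trans ?_
  rw [intervalIntegral.integral_const_mul, intervalIntegral.integral_add (hexp.const_mul _)
    (hU.const_mul _), intervalIntegral.integral_const_mul, intervalIntegral.integral_const_mul]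
  gcongr

/-! ### The energy inequality -/

/-- The inequality `½ d/dt ‖y‖² + μ ‖U‖² + (memory, U) ≤ M ‖U‖` on `(t₀, t₁)`, which holds for a
parabolic equation with memory tested with its own solution: `U` stands for the gradient and `M`
for the dual norm of the force. -/
structure EnergyInequality {X E : Type*} [NormedAddCommGroup X] [InnerProductSpace ℝ X]
    [NormedAddCommGroup E] [InnerProductSpace ℝ E] (μ γ δ M : ℝ) (U : ℝ → E) (y : ℝ → X)
    (t₀ t₁ : ℝ) : Prop where
  memLp : MemLp U 2 (volume.restrict (Ioc t₀ t₁))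
  continuousOn : ContinuousOn y (Icc t₀ t₁)
  deriv_le : ∀ t ∈ Ioo t₀ t₁, ∃ y', HasDerivAt y y' t ∧
    inner ℝ y' (y t) + μ * ‖U t‖ ^ 2 + inner ℝ (memory γ δ t₀ U t) (U t) ≤ M * ‖U t‖

theorem intervalIntegrable_exp_mul_norm_sq {E : Type*} [NormedAddCommGroup E] {U : ℝ → E}
    {t₀ t₁ : ℝ} (h01 : t₀ ≤ t₁) (hU : MemLp U 2 (volume.restrict (Ioc t₀ t₁))) (c : ℝ) :
    IntervalIntegrable (fun s => Real.exp (c * s) * ‖U s‖ ^ 2) volume t₀ t₁ := by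
  refine IntervalIntegrable.continuousOn_mul ?_ (by fun_prop)
  rw [intervalIntegrable_iff_integrableOn_Ioc_of_le h01]
  exact hU.integrable_norm_pow (by norm_num)

namespace EnergyInequality

variable {X E : Type*} [NormedAddCommGroup X] [InnerProductSpace ℝ X]
  [NormedAddCommGroup E] [InnerProductSpace ℝ E] {μ γ δ α M t₀ t₁ B C : ℝ} {U : ℝ → E} {y : ℝ → X}

theorem intervalIntegrable (hE : EnergyInequality μ γ δ M U y t₀ t₁) (h01 : t₀ ≤ t₁) :
    IntervalIntegrable U volume t₀ t₁ := by
  rw [intervalIntegrable_iff_integrableOn_Ioc_of_le h01]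
  exact hE.memLp.integrable (by norm_num)

theorem intervalIntegrable_exp_mul_norm_sq_energy (hE : EnergyInequality μ γ δ M U y t₀ t₁)
    (h01 : t₀ ≤ t₁) (c : ℝ) :
    IntervalIntegrable (fun s => Real.exp (c * s) * ‖y s‖ ^ 2) volume t₀ t₁ := by
  have hy := hE.continuousOn
  rw [← uIcc_of_le h01] at hy
  exact ContinuousOn.intervalIntegrable (by fun_prop)

theorem two_mul_inner_deriv_le (hμ : 0 < μ) {y' : X} {t : ℝ}
    (h : inner ℝ y' (y t) + μ * ‖U t‖ ^ 2 + inner ℝ (memory γ δ t₀ U t) (U t) ≤ M * ‖U t‖) :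
    2 * inner ℝ (y t) y' ≤ M ^ 2 / μ - μ * ‖U t‖ ^ 2 - 2 * inner ℝ (memory γ δ t₀ U t) (U t) := by
  have hyoung : 2 * (M * ‖U t‖) ≤ M ^ 2 / μ + μ * ‖U t‖ ^ 2 := by
    have hsq : M ^ 2 / μ + μ * ‖U t‖ ^ 2 - 2 * (M * ‖U t‖) = (M - μ * ‖U t‖) ^ 2 / μ := by
      field_simp
      ring
    have : 0 ≤ (M - μ * ‖U t‖) ^ 2 / μ := by positivity
    linarith
  rw [real_inner_comm]
  linarith

theorem weighted [CompleteSpace E] (hE : EnergyInequality μ γ δ M U y t₀ t₁) (hμ : 0 < μ)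
    (hγ : 0 ≤ γ) (hα₀ : 0 < α) (hα : α ≤ δ) (h01 : t₀ ≤ t₁) :
    Real.exp (2 * α * t₁) * ‖y t₁‖ ^ 2 + μ * ∫ s in t₀..t₁, Real.exp (2 * α * s) * ‖U s‖ ^ 2 ≤
      Real.exp (2 * α * t₀) * ‖y t₀‖ ^ 2
        + 2 * α * (∫ s in t₀..t₁, Real.exp (2 * α * s) * ‖y s‖ ^ 2)
        + Real.exp (2 * α * t₁) * (M ^ 2 / μ / (2 * α)) := by
  have hforce : M ^ 2 / μ * ∫ s in t₀..t₁, Real.exp (2 * α * s)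
      ≤ Real.exp (2 * α * t₁) * (M ^ 2 / μ / (2 * α)) :=
    calc _ ≤ M ^ 2 / μ * (Real.exp (2 * α * t₁) / (2 * α)) := by
          rw [integral_exp_two_mul hα₀.ne']
          gcongr
          exact sub_le_self _ (by positivity)
      _ = _ := by ring
  have hU := hE.intervalIntegrable h01
  have iU := intervalIntegrable_exp_mul_norm_sq h01 hE.memLp (2 * α)
  have iy := hE.intervalIntegrable_exp_mul_norm_sq_energy h01 (2 * α)
  have ie : IntervalIntegrable (fun s => Real.exp (2 * α * s)) volume t₀ t₁ :=
    Continuous.intervalIntegrable (by fun_prop) _ _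
  have im := intervalIntegrable_exp_mul_inner_memory γ δ α hU
  have hy := hE.continuousOn
  choose! y' hy' using hE.deriv_le
  have hincrement := intervalIntegral.sub_le_integral_of_hasDeriv_right_of_le h01
    (g := fun t => Real.exp (2 * α * t) * ‖y t‖ ^ 2)
    (g' := fun t => Real.exp (2 * α * t) * (2 * α) * ‖y t‖ ^ 2
      + Real.exp (2 * α * t) * (2 * inner ℝ (y t) (y' t)))
    (by fun_prop) (fun t ht => ?_)
    ((intervalIntegrable_iff_integrableOn_Icc_of_le h01).1
      ((((iy.const_mul (2 * α)).add (ie.const_mul (M ^ 2 / μ))).sub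
        (iU.const_mul μ)).sub (im.const_mul 2))) (fun t ht => ?_)
  · rw [intervalIntegral.integral_sub (((iy.const_mul _).add (ie.const_mul _)).sub
      (iU.const_mul _)) (im.const_mul _),
      intervalIntegral.integral_sub ((iy.const_mul _).add (ie.const_mul _)) (iU.const_mul _),
      intervalIntegral.integral_add (iy.const_mul _) (ie.const_mul _)] at hincrement
    simp only [intervalIntegral.integral_const_mul] at hincrement
    linarith [integral_exp_mul_inner_memory_nonneg hγ hα h01 hU]
  · have hexp : HasDerivAt (fun x => Real.exp (2 * α * x)) (Real.exp (2 * α * t) * (2 * α)) t := by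
      simpa using ((hasDerivAt_id t).const_mul (2 * α)).exp
    exact (hexp.mul (hy' t ht).1.norm_sq).hasDerivWithinAt
  · have := mul_le_mul_of_nonneg_left (two_mul_inner_deriv_le hμ (hy' t ht).2)
      (Real.exp_pos (2 * α * t)).le
    linarith

/-- For a small weight `α` the dissipation absorbs the term produced by the weight. -/
theorem norm_sq_le [CompleteSpace E] (hE : EnergyInequality μ γ δ M U y t₀ t₁) (hμ : 0 < μ)
    (hγ : 0 ≤ γ) (hα₀ : 0 < α) (hα : α ≤ δ) (hαC : 2 * α * C ^ 2 ≤ μ) (h01 : t₀ ≤ t₁)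
    (hyU : ∀ t ∈ Ioo t₀ t₁, ‖y t‖ ≤ C * ‖U t‖) :
    ‖y t₁‖ ^ 2 ≤ ‖y t₀‖ ^ 2 + M ^ 2 / μ / (2 * α) := by
  have hweighted := hE.weighted hμ hγ hα₀ hα h01
  have habsorb : 2 * α * (∫ s in t₀..t₁, Real.exp (2 * α * s) * ‖y s‖ ^ 2)
      ≤ μ * ∫ s in t₀..t₁, Real.exp (2 * α * s) * ‖U s‖ ^ 2 := by
    rw [← intervalIntegral.integral_const_mul, ← intervalIntegral.integral_const_mul]
    refine intervalIntegral.integral_mono_on_of_le_Ioo h01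
      ((hE.intervalIntegrable_exp_mul_norm_sq_energy h01 _).const_mul _)
      ((intervalIntegrable_exp_mul_norm_sq h01 hE.memLp _).const_mul _) fun s hs => ?_
    have : 2 * α * ‖y s‖ ^ 2 ≤ μ * ‖U s‖ ^ 2 :=
      calc 2 * α * ‖y s‖ ^ 2 ≤ 2 * α * (C * ‖U s‖) ^ 2 := by gcongr; exact hyU s hs
        _ = 2 * α * C ^ 2 * ‖U s‖ ^ 2 := by ring
        _ ≤ μ * ‖U s‖ ^ 2 := by gcongr
    linarith [mul_le_mul_of_nonneg_left this (Real.exp_pos (2 * α * s)).le]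
  have hinit : Real.exp (2 * α * t₀) * ‖y t₀‖ ^ 2 ≤ Real.exp (2 * α * t₁) * ‖y t₀‖ ^ 2 := by
    gcongr
  refine le_of_mul_le_mul_left ?_ (Real.exp_pos (2 * α * t₁))
  linarith

theorem exp_mul_integral_le [CompleteSpace E] (hE : EnergyInequality μ γ δ M U y t₀ t₁)
    (hμ : 0 < μ) (hγ : 0 ≤ γ) (hα₀ : 0 < α) (hα : α ≤ δ) (h01 : t₀ ≤ t₁)
    (hB : ∀ t ∈ Icc t₀ t₁, ‖y t‖ ^ 2 ≤ B) :
    Real.exp (-2 * α * t₁) * ∫ s in t₀..t₁, Real.exp (2 * α * s) * ‖U s‖ ^ 2 ≤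
      (B + M ^ 2 / μ / (2 * α)) / μ := by
  have hweighted := hE.weighted hμ hγ hα₀ hα h01
  have hyB : ∫ s in t₀..t₁, Real.exp (2 * α * s) * ‖y s‖ ^ 2
      ≤ ∫ s in t₀..t₁, Real.exp (2 * α * s) * B := by
    refine intervalIntegral.integral_mono_on h01
      (hE.intervalIntegrable_exp_mul_norm_sq_energy h01 _)
      (Continuous.intervalIntegrable (by fun_prop) _ _) fun s hs => ?_
    gcongr
    exact hB s hs
  rw [intervalIntegral.integral_mul_const] at hyB
  rw [integral_exp_two_mul hα₀.ne'] at hyB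
  set A₀ := Real.exp (2 * α * t₀)
  set A₁ := Real.exp (2 * α * t₁)
  have hA₁ : 0 < A₁ := Real.exp_pos _
  have hweight : 2 * α * ((A₁ - A₀) / (2 * α) * B) = (A₁ - A₀) * B := by field_simp
  have hinit : A₀ * ‖y t₀‖ ^ 2 ≤ A₀ * B := by gcongr; exact hB t₀ (left_mem_Icc.2 h01)
  have hend : 0 ≤ A₁ * ‖y t₁‖ ^ 2 := by positivity
  have hexp : Real.exp (-2 * α * t₁) = A₁⁻¹ := by rw [← Real.exp_neg]; ring_nf
  rw [le_div_iff₀ hμ, hexp, inv_mul_eq_div, div_mul_eq_mul_div, div_le_iff₀ hA₁]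
  linarith [mul_le_mul_of_nonneg_left hyB (by positivity : 0 ≤ 2 * α)]

end EnergyInequality

/-! ### Sobolev inequalities on `H¹₀(Ω)` -/

instance (Ω : PlanarDomain) : IsFiniteMeasure (vol Ω) :=
  ⟨by simpa using Ω.isBounded.measure_lt_top⟩

theorem norm_fderiv_le_sum_classicalPd (φ : Plane → ℝ) (x : Plane) :
    ‖fderiv ℝ φ x‖ ≤ ∑ j, ‖classicalPd j φ x‖ := by
  refine ContinuousLinearMap.opNorm_le_bound _ (by positivity) fun v => ?_
  have hv : v = ∑ j, v j • EuclideanSpace.single j (1 : ℝ) := by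
    ext i
    fin_cases i <;> simp
  have hfderiv : fderiv ℝ φ x v = ∑ j, v j * classicalPd j φ x := by
    conv_lhs => rw [hv]
    simp [classicalPd]
  rw [hfderiv, Finset.sum_mul]
  refine (norm_sum_le _ _).trans (Finset.sum_le_sum fun j _ => ?_)
  rw [norm_mul, mul_comm]
  gcongr
  exact PiLp.norm_apply_le v j

variable {Ω : PlanarDomain}

namespace IsTest

variable {φ : Plane → ℝ}

theorem continuous_classicalPd (hφ : IsTest Ω φ) (j : Fin 2) : Continuous (classicalPd j φ) :=
  (hφ.1.continuous_fderiv (by simp)).clm_apply continuous_const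

theorem hasCompactSupport_classicalPd (hφ : IsTest Ω φ) (j : Fin 2) :
    HasCompactSupport (classicalPd j φ) :=
  hφ.2.1.fderiv_apply (𝕜 := ℝ) (EuclideanSpace.single j 1)

theorem memLp (hφ : IsTest Ω φ) (p : ENNReal) : MemLp φ p (vol Ω) :=
  hφ.1.continuous.memLp_of_hasCompactSupport hφ.2.1

theorem memLp_classicalPd (hφ : IsTest Ω φ) (j : Fin 2) (p : ENNReal) :
    MemLp (classicalPd j φ) p (vol Ω) :=
  (hφ.continuous_classicalPd j).memLp_of_hasCompactSupport (hφ.hasCompactSupport_classicalPd j)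

/-- The class of a test function in `L²(Ω)`. -/
noncomputable def toL2 (hφ : IsTest Ω φ) : L2 Ω := (hφ.memLp 2).toLp φ

/-- The class in `L²(Ω)` of the partial derivative `∂ⱼ φ` of a test function. -/
noncomputable def pdToL2 (hφ : IsTest Ω φ) (j : Fin 2) : L2 Ω :=
  (hφ.memLp_classicalPd j 2).toLp (classicalPd j φ)

theorem add {ψ : Plane → ℝ} (hφ : IsTest Ω φ) (hψ : IsTest Ω ψ) : IsTest Ω (φ + ψ) :=
  ⟨hφ.1.add hψ.1, hφ.2.1.add hψ.2.1,
    (tsupport_add φ ψ).trans (union_subset hφ.2.2 hψ.2.2)⟩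

theorem classicalPd_add {ψ : Plane → ℝ} (hφ : IsTest Ω φ) (hψ : IsTest Ω ψ) (j : Fin 2) :
    classicalPd j (φ + ψ) = classicalPd j φ + classicalPd j ψ := by
  ext x
  simp [classicalPd, fderiv_add (hφ.1.differentiable (by simp) x)
    (hψ.1.differentiable (by simp) x)]

theorem sq (hφ : IsTest Ω φ) : IsTest Ω (fun x => φ x ^ 2) := by
  refine ⟨hφ.1.pow 2, hφ.2.1.comp_left (g := fun t : ℝ => t ^ 2) (by simp),
    (closure_mono fun x hx => ?_).trans hφ.2.2⟩
  contrapose! hx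
  simpa using hx

theorem eLpNorm_fderiv_le (hφ : IsTest Ω φ) :
    eLpNorm (fderiv ℝ φ) 2 (vol Ω) ≤ ∑ j, ‖hφ.pdToL2 j‖ₑ := by
  calc eLpNorm (fderiv ℝ φ) 2 (vol Ω)
      ≤ eLpNorm (∑ j, fun x => ‖classicalPd j φ x‖) 2 (vol Ω) := by
        refine eLpNorm_mono fun x => ?_
        rw [Finset.sum_apply, Real.norm_of_nonneg (by positivity)]
        exact norm_fderiv_le_sum_classicalPd φ x
    _ ≤ ∑ j, eLpNorm (fun x => ‖classicalPd j φ x‖) 2 (vol Ω) :=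
        eLpNorm_sum_le (fun j _ => (hφ.continuous_classicalPd j).norm.aestronglyMeasurable)
          (by norm_num)
    _ = ∑ j, ‖hφ.pdToL2 j‖ₑ := by simp only [eLpNorm_norm, pdToL2, Lp.enorm_toLp]

theorem integral_classicalPd (hφ : IsTest Ω φ) (j : Fin 2) :
    ∫ x, classicalPd j φ x ∂(vol Ω) = 0 := by
  have hsupp : ∀ x ∉ Ω.carrier, classicalPd j φ x = 0 := fun x hx => by
    have : fderiv ℝ φ x = 0 := by
      by_contra h
      exact hx (hφ.2.2 (support_fderiv_subset ℝ h))
    simp [classicalPd, this]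
  have hφ' : Integrable (classicalPd j φ) volume :=
    (hφ.continuous_classicalPd j).integrable_of_hasCompactSupport
      (hφ.hasCompactSupport_classicalPd j)
  rw [setIntegral_eq_integral_of_forall_compl_eq_zero hsupp]
  have := integral_mul_fderiv_eq_neg_fderiv_mul_of_integrable (μ := (volume : Measure Plane))
    (f := fun _ : Plane => (1 : ℝ)) (g := φ) (v := EuclideanSpace.single j 1) (by simp)
    (by simpa using! hφ')
    (by simpa using! hφ.1.continuous.integrable_of_hasCompactSupport hφ.2.1)
    (by fun_prop) (fun x _ => hφ.1.differentiable (by simp) x)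
  simpa [classicalPd] using this

end IsTest

theorem exists_gagliardo_nirenberg_test (Ω : PlanarDomain) : ∃ C : NNReal, ∀ φ : Plane → ℝ,
    IsTest Ω φ → eLpNorm φ 2 (vol Ω) ≤ C * eLpNorm (fderiv ℝ φ) 1 (vol Ω) := by
  refine ⟨eLpNormLESNormFDerivOneConst (volume : Measure Plane) ((2 : NNReal) : ℝ), fun φ hφ => ?_⟩
  have hdim : NNReal.HolderConjugate (Module.finrank ℝ Plane) 2 := by
    rw [finrank_euclideanSpace_fin]
    exact NNReal.HolderConjugate.two_two
  have hplane : eLpNorm φ ((2 : NNReal) : ENNReal) volume ≤ _ :=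
    eLpNorm_le_eLpNorm_fderiv_one (volume : Measure Plane) (hφ.1.of_le (by simp)) hφ.2.1 hdim
  have hsupp : Function.support (fun x => ‖fderiv ℝ φ x‖) ⊆ Ω.carrier :=
    fun x hx => hφ.2.2 (support_fderiv_subset ℝ (norm_ne_zero_iff.1 hx))
  rw [← eLpNorm_norm (fderiv ℝ φ), ← eLpNorm_restrict_eq_of_support_subset hsupp,
    eLpNorm_norm] at hplane
  exact (eLpNorm_mono_measure _ Measure.restrict_le_self).trans hplane

theorem exists_poincare_test (Ω : PlanarDomain) : ∃ C : NNReal, ∀ (φ : Plane → ℝ)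
    (hφ : IsTest Ω φ), ‖hφ.toL2‖ₑ ≤ C * ∑ j, ‖hφ.pdToL2 j‖ₑ := by
  obtain ⟨C, hC⟩ := exists_gagliardo_nirenberg_test Ω
  set m : ENNReal := (vol Ω) univ ^ (1 / (1 : ENNReal).toReal - 1 / (2 : ENNReal).toReal)
  have hm : m ≠ ⊤ := ENNReal.rpow_ne_top_of_nonneg (by norm_num) (measure_ne_top _ _)
  refine ⟨C * m.toNNReal, fun φ hφ => ?_⟩
  calc ‖hφ.toL2‖ₑ = eLpNorm φ 2 (vol Ω) := Lp.enorm_toLp _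
    _ ≤ C * eLpNorm (fderiv ℝ φ) 1 (vol Ω) := hC φ hφ
    _ ≤ C * (eLpNorm (fderiv ℝ φ) 2 (vol Ω) * m) := by
        gcongr
        exact eLpNorm_le_eLpNorm_mul_rpow_measure_univ (by norm_num)
          (hφ.1.continuous_fderiv (by simp)).aestronglyMeasurable
    _ ≤ C * ((∑ j, ‖hφ.pdToL2 j‖ₑ) * m) := by gcongr; exact hφ.eLpNorm_fderiv_le
    _ = _ := by rw [ENNReal.coe_mul, ENNReal.coe_toNNReal hm]; ring

/-- Gagliardo–Nirenberg for `φ²`, whose `L²` norm is the square of the `L⁴` norm of `φ`. -/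
theorem exists_ladyzhenskaya_test (Ω : PlanarDomain) : ∃ C : NNReal, ∀ (φ : Plane → ℝ)
    (hφ : IsTest Ω φ), eLpNorm φ 4 (vol Ω) ≤
      (C * (‖hφ.toL2‖ₑ * ∑ j, ‖hφ.pdToL2 j‖ₑ)) ^ (1 / 2 : ℝ) := by
  obtain ⟨C, hC⟩ := exists_gagliardo_nirenberg_test Ω
  refine ⟨C * 2, fun φ hφ => ?_⟩
  have hsq : eLpNorm (fun x => φ x ^ 2) 2 (vol Ω) = eLpNorm φ 4 (vol Ω) ^ (2 : ℝ) := by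
    have := eLpNorm_norm_rpow (μ := vol Ω) (p := 2) φ (q := 2) (by norm_num)
    simpa [show (2 : ENNReal) * 2 = 4 by norm_num] using this
  have hderiv : fderiv ℝ (fun x => φ x ^ 2) = ((2 : ℝ) • φ) • fderiv ℝ φ := by
    ext1 x
    rw [fderiv_fun_pow 2 (hφ.1.differentiable (by simp) x)]
    simp
  have hφc := hφ.1.continuous
  rw [one_div, ENNReal.le_rpow_inv_iff two_pos, ← hsq]
  calc eLpNorm (fun x => φ x ^ 2) 2 (vol Ω)
      ≤ C * eLpNorm (((2 : ℝ) • φ) • fderiv ℝ φ) 1 (vol Ω) := hderiv ▸ hC _ hφ.sq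
    _ ≤ C * (eLpNorm ((2 : ℝ) • φ) 2 (vol Ω) * eLpNorm (fderiv ℝ φ) 2 (vol Ω)) := by
        gcongr
        exact eLpNorm_smul_le_mul_eLpNorm (hφ.1.continuous_fderiv (by simp)).aestronglyMeasurable
          (hφc.const_smul 2).aestronglyMeasurable
    _ = C * (2 * ‖hφ.toL2‖ₑ * eLpNorm (fderiv ℝ φ) 2 (vol Ω)) := by
        rw [eLpNorm_const_smul, IsTest.toL2, Lp.enorm_toLp]
        simp [enorm_eq_nnnorm]
    _ ≤ C * (2 * ‖hφ.toL2‖ₑ * ∑ j, ‖hφ.pdToL2 j‖ₑ) := by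
        gcongr
        exact hφ.eLpNorm_fderiv_le
    _ = _ := by push_cast; ring

theorem eLpNorm_le_of_tendsto_Lp {X F : Type*} [MeasurableSpace X] [NormedAddCommGroup F]
    {ν : Measure X} {p q : ENNReal} [Fact (1 ≤ p)] {u : ℕ → Lp F p ν} {v : Lp F p ν}
    (hu : Tendsto u atTop (𝓝 v)) {B : ℕ → ENNReal} {B' : ENNReal} (hB : Tendsto B atTop (𝓝 B'))
    (hle : ∀ n, eLpNorm (u n) q ν ≤ B n) : eLpNorm v q ν ≤ B' := by
  obtain ⟨ns, hns, hae⟩ := (tendstoInMeasure_of_tendsto_Lp hu).exists_seq_tendsto_ae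
  rw [← (hB.comp hns.tendsto_atTop).liminf_eq]
  exact (Lp.eLpNorm_lim_le_liminf_eLpNorm (fun k => Lp.aestronglyMeasurable _) v hae).trans
    (liminf_le_liminf (Eventually.of_forall fun k => hle (ns k)))

theorem memH10_iff_exists_seq {u : L2 Ω} :
    MemH10 u ↔ MemH1 u ∧ ∃ (φ : ℕ → Plane → ℝ) (hφ : ∀ n, IsTest Ω (φ n)),
      Tendsto (fun n => (hφ n).toL2) atTop (𝓝 u) ∧
      ∀ j, Tendsto (fun n => (hφ n).pdToL2 j) atTop (𝓝 (pd j u)) := by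
  have htendsto : ∀ {ψ : ℕ → Plane → ℝ} (hψ : ∀ n, MemLp (ψ n) 2 (vol Ω)) (g : L2 Ω),
      Tendsto (fun n => (hψ n).toLp (ψ n)) atTop (𝓝 g) ↔
        Tendsto (fun n => eLpNorm (fun x => g x - ψ n x) 2 (vol Ω)) atTop (𝓝 0) := by
    intro ψ hψ g
    conv_lhs => rw [← Lp.toLp_coeFn g (Lp.memLp g), Lp.tendsto_Lp_iff_tendsto_eLpNorm'']
    refine tendsto_congr fun n => ?_
    rw [eLpNorm_sub_comm]
    rfl
  simp only [IsTest.toL2, IsTest.pdToL2, htendsto, exists_prop, MemH10]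

theorem MemH10.add {u v : L2 Ω} (hu : MemH10 u) (hv : MemH10 v) : MemH10 (u + v) := by
  have hpd : ∀ j, HasWeakPd j (u + v) (pd j u + pd j v) := fun j =>
    (hu.1.hasWeakPd j).add (hv.1.hasWeakPd j)
  obtain ⟨-, φ, hφ, hφu, hφu'⟩ := memH10_iff_exists_seq.1 hu
  obtain ⟨-, ψ, hψ, hψv, hψv'⟩ := memH10_iff_exists_seq.1 hv
  refine memH10_iff_exists_seq.2 ⟨fun j => ⟨_, hpd j⟩, fun n => φ n + ψ n,
    fun n => (hφ n).add (hψ n), hφu.add hψv, fun j => ?_⟩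
  rw [(hpd j).pd_eq]
  refine ((hφu' j).add (hψv' j)).congr fun n => ?_
  simp only [IsTest.pdToL2, (hφ n).classicalPd_add (hψ n)]
  exact (MemLp.toLp_add _ _).symm

theorem exists_poincare (Ω : PlanarDomain) : ∃ C : NNReal, ∀ u : L2 Ω, MemH10 u →
    ‖u‖ ≤ C * ∑ j, ‖pd j u‖ := by
  obtain ⟨C, hC⟩ := exists_poincare_test Ω
  refine ⟨C, fun u hu => ?_⟩
  obtain ⟨-, φ, hφ, hφu, hφu'⟩ := memH10_iff_exists_seq.1 hu
  have hlim : ‖u‖ₑ ≤ C * ∑ j, ‖pd j u‖ₑ :=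
    le_of_tendsto_of_tendsto' hφu.enorm
      (ENNReal.Tendsto.const_mul (tendsto_finsetSum _ fun j _ => (hφu' j).enorm)
        (.inr ENNReal.coe_ne_top)) fun n => hC (φ n) (hφ n)
  simp only [enorm_eq_nnnorm] at hlim
  exact_mod_cast hlim

theorem exists_ladyzhenskaya (Ω : PlanarDomain) : ∃ C : NNReal, ∀ u : L2 Ω, MemH10 u →
    eLpNorm u 4 (vol Ω) ≤ (C * (‖u‖ₑ * ∑ j, ‖pd j u‖ₑ)) ^ (1 / 2 : ℝ) := by
  obtain ⟨C, hC⟩ := exists_ladyzhenskaya_test Ω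
  refine ⟨C, fun u hu => ?_⟩
  obtain ⟨-, φ, hφ, hφu, hφu'⟩ := memH10_iff_exists_seq.1 hu
  refine eLpNorm_le_of_tendsto_Lp hφu ?_ fun n =>
    (eLpNorm_congr_ae ((hφ n).memLp 2).coeFn_toLp).trans_le (hC (φ n) (hφ n))
  have hsum : Tendsto (fun n => ∑ j, ‖(hφ n).pdToL2 j‖ₑ) atTop (𝓝 (∑ j, ‖pd j u‖ₑ)) :=
    tendsto_finsetSum _ fun j _ => (hφu' j).enorm
  exact (ENNReal.continuous_rpow_const.tendsto _).comp (ENNReal.Tendsto.const_mul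
    (ENNReal.Tendsto.mul hφu.enorm (.inr (by simp)) hsum (.inr (by simp)))
    (.inr ENNReal.coe_ne_top))

theorem MemH10.integral_pd {u : L2 Ω} (hu : MemH10 u) (j : Fin 2) :
    ∫ x, pd j u x ∂(vol Ω) = 0 := by
  obtain ⟨-, φ, hφ, -, hφu'⟩ := memH10_iff_exists_seq.1 hu
  have hint : ∀ g : L2 Ω, inner ℝ (indicatorConstLp 2 MeasurableSet.univ
      (measure_ne_top (vol Ω) univ) (1 : ℝ)) g = ∫ x, g x ∂(vol Ω) := fun g => by
    rw [L2.inner_indicatorConstLp_one, setIntegral_univ]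
  rw [← hint]
  refine tendsto_nhds_unique (tendsto_const_nhds.inner (hφu' j))
    (tendsto_const_nhds.congr fun n => ?_)
  rw [hint, IsTest.pdToL2, integral_congr_ae (MemLp.coeFn_toLp _), (hφ n).integral_classicalPd]

/-! ### The gradient -/

/-- The Jacobian matrix `∇v`, with the entry `∂ⱼ vᵢ` at `(i, j)`, in `L²(Ω)^{2 × 2}`; it carries the
Hilbert space structure that turns `a` into an inner product. -/
noncomputable def grad (v : VL2 Ω) : PiLp 2 (fun _ : Fin 2 × Fin 2 => L2 Ω) :=
  WithLp.toLp 2 fun p => pd p.2 (v p.1)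

theorem inner_grad (v w : VL2 Ω) : inner ℝ (grad v) (grad w) = a v w := by
  rw [PiLp.inner_apply, Fintype.sum_prod_type]
  rfl

theorem norm_grad (v : VL2 Ω) : ‖grad v‖ = gradNorm v := by
  rw [PiLp.norm_eq_of_L2, Fintype.sum_prod_type]
  rfl

theorem gradNorm_nonneg (v : VL2 Ω) : 0 ≤ gradNorm v := Real.sqrt_nonneg _

theorem a_self (v : VL2 Ω) : a v v = gradNorm v ^ 2 := by
  rw [← inner_grad, real_inner_self_eq_norm_sq, norm_grad]

theorem abs_a_le (v w : VL2 Ω) : |a v w| ≤ gradNorm v * gradNorm w := by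
  simpa only [inner_grad, norm_grad] using abs_real_inner_le_norm (grad v) (grad w)

theorem norm_pd_le_gradNorm (v : VL2 Ω) (i j : Fin 2) : ‖pd j (v i)‖ ≤ gradNorm v :=
  (PiLp.norm_apply_le (grad v) (i, j)).trans_eq (norm_grad v)

theorem MemH10.pd_add {u v : L2 Ω} (hu : MemH10 u) (hv : MemH10 v) (j : Fin 2) :
    pd j (u + v) = pd j u + pd j v :=
  ((hu.1.hasWeakPd j).add (hv.1.hasWeakPd j)).pd_eq

theorem MemH10.pd_smul {u : L2 Ω} (hu : MemH10 u) (c : ℝ) (j : Fin 2) :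
    pd j (c • u) = c • pd j u :=
  ((hu.1.hasWeakPd j).smul c).pd_eq

theorem VMemH10.add {v w : VL2 Ω} (hv : VMemH10 v) (hw : VMemH10 w) : VMemH10 (v + w) :=
  fun i => (hv i).add (hw i)

theorem VMemH10.grad_add {v w : VL2 Ω} (hv : VMemH10 v) (hw : VMemH10 w) :
    grad (v + w) = grad v + grad w := by
  ext1 p
  exact (hv p.1).pd_add (hw p.1) p.2

theorem VMemH10.grad_smul {v : VL2 Ω} (hv : VMemH10 v) (c : ℝ) : grad (c • v) = c • grad v := by
  ext1 p
  exact (hv p.1).pd_smul c p.2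

theorem FEPair.memLp_grad (S : FEPair Ω) {X : Type*} [MeasurableSpace X] {ν : Measure X}
    {p : ENNReal} {u : X → VL2 Ω} (hu : MemLp u p ν) (hmem : ∀ᵐ x ∂ν, u x ∈ S.velocity) :
    MemLp (fun x => grad (u x)) p ν := by
  have := S.finiteVelocity
  let G : S.velocity →ₗ[ℝ] PiLp 2 (fun _ : Fin 2 × Fin 2 => L2 Ω) :=
    { toFun := fun v => grad (v : VL2 Ω)
      map_add' := fun v w => (S.velocity_mem v v.2).grad_add (S.velocity_mem w w.2)
      map_smul' := fun c v => (S.velocity_mem v v.2).grad_smul c }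
  refine ((G.toContinuousLinearMap ∘L S.velocity.orthogonalProjectionOnto).comp_memLp' hu).ae_eq ?_
  filter_upwards [hmem] with x hx
  have hproj : S.velocity.orthogonalProjectionOnto (u x) = ⟨u x, hx⟩ :=
    Submodule.orthogonalProjectionOnto_mem_subspace_eq_self (⟨u x, hx⟩ : S.velocity)
  simp [hproj, G]

theorem integral_kernel_mul_a (γ δ : ℝ) {t₀ t : ℝ} {u : ℝ → VL2 Ω}
    (hu : IntervalIntegrable (fun s => grad (u s)) volume t₀ t) (φ : VL2 Ω) :
    ∫ s in t₀..t, kernel γ δ (t - s) * a (u s) φ =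
      inner ℝ (memory γ δ t₀ (fun s => grad (u s)) t) (grad φ) := by
  simp only [inner_memory γ δ hu, inner_grad]

theorem exists_vector_poincare (Ω : PlanarDomain) : ∃ C : ℝ, 0 < C ∧ ∀ v : VL2 Ω, VMemH10 v →
    ‖v‖ ≤ C * gradNorm v := by
  obtain ⟨C, hC⟩ := exists_poincare Ω
  refine ⟨4 * C + 1, by positivity, fun v hv => ?_⟩
  have hg := gradNorm_nonneg v
  calc ‖v‖ ≤ ∑ i, ‖v i‖ := by
        rw [PiLp.norm_eq_of_L2]
        exact Real.sqrt_le_left (by positivity) |>.2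
          (Finset.sum_sq_le_sq_sum_of_nonneg fun i _ => norm_nonneg (v i))
    _ ≤ ∑ i, C * ∑ j, ‖pd j (v i)‖ := Finset.sum_le_sum fun i _ => hC _ (hv i)
    _ ≤ ∑ _i : Fin 2, C * ∑ _j : Fin 2, gradNorm v := by
        gcongr with i _ j
        exact norm_pd_le_gradNorm v i j
    _ ≤ (4 * C + 1) * gradNorm v := by
        simp only [Finset.sum_const, Finset.card_univ, Fintype.card_fin, nsmul_eq_mul,
          Nat.cast_ofNat]
        linarith

/-! ### The trilinear form -/

theorem holderTriple_four_four_two : ENNReal.HolderTriple 4 4 2 where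
  inv_add_inv_eq_inv := by
    rw [← two_mul, show (4 : ENNReal) = 2 * 2 by norm_num,
      ENNReal.mul_inv (by simp) (by simp), ENNReal.mul_inv_cancel_left (by simp) (by simp)]

section Holder

attribute [local instance] holderTriple_four_four_two

variable {X : Type*} [MeasurableSpace X] {ν : Measure X} {p g q : X → ℝ}

theorem integrable_mul_mul (hp : MemLp p 4 ν) (hg : MemLp g 2 ν) (hq : MemLp q 4 ν) :
    Integrable (fun x => p x * g x * q x) ν := by
  have hpq : MemLp (p * q) 2 ν := hq.mul hp
  refine (hpq.integrable_mul hg).congr (Eventually.of_forall fun x => ?_)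
  simp only [Pi.mul_apply]
  ring

theorem abs_integral_mul_mul_le (hp : MemLp p 4 ν) (hg : MemLp g 2 ν) (hq : MemLp q 4 ν) :
    |∫ x, p x * g x * q x ∂ν| ≤
      (eLpNorm p 4 ν).toReal * (eLpNorm g 2 ν).toReal * (eLpNorm q 4 ν).toReal := by
  have hpq : AEStronglyMeasurable (p • q) ν := hp.1.smul hq.1
  have hle : ‖∫ x, p x * g x * q x ∂ν‖ₑ ≤ eLpNorm p 4 ν * eLpNorm g 2 ν * eLpNorm q 4 ν :=
    calc ‖∫ x, p x * g x * q x ∂ν‖ₑ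
        ≤ eLpNorm (fun x => p x * g x * q x) 1 ν := by
          rw [eLpNorm_one_eq_lintegral_enorm]
          exact enorm_integral_le_lintegral_enorm _
      _ = eLpNorm ((p • q) • g) 1 ν := by
          congr 1
          ext x
          simp only [smul_eq_mul, Pi.mul_apply]
          ring
      _ ≤ eLpNorm (p • q) 2 ν * eLpNorm g 2 ν := eLpNorm_smul_le_mul_eLpNorm hg.1 hpq
      _ ≤ eLpNorm p 4 ν * eLpNorm q 4 ν * eLpNorm g 2 ν := by
          gcongr
          exact eLpNorm_smul_le_mul_eLpNorm hq.1 hp.1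
      _ = _ := by ring
  rw [← Real.norm_eq_abs, ← toReal_enorm, ← ENNReal.toReal_mul, ← ENNReal.toReal_mul]
  exact ENNReal.toReal_mono
    (ENNReal.mul_ne_top (ENNReal.mul_ne_top hp.2.ne hg.2.ne) hq.2.ne) hle

end Holder

/-- The norm `∑ᵢ ‖vᵢ‖_{L⁴(Ω)}`, equivalent to that of `𝐋⁴`. It is meant for `v ∈ 𝐇¹₀ ⊆ 𝐋⁴`:
an infinite summand is read as `0`. -/
noncomputable def l4Norm (v : VL2 Ω) : ℝ := ∑ i, (eLpNorm (v i) 4 (vol Ω)).toReal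

theorem l4Norm_nonneg (v : VL2 Ω) : 0 ≤ l4Norm v := Finset.sum_nonneg fun _ _ => by positivity

theorem MemH10.memLp_four {u : L2 Ω} (hu : MemH10 u) : MemLp u 4 (vol Ω) := by
  obtain ⟨C, hC⟩ := exists_ladyzhenskaya Ω
  refine ⟨Lp.aestronglyMeasurable u, (hC u hu).trans_lt
    (ENNReal.rpow_lt_top_of_nonneg (by norm_num) ?_)⟩
  exact ENNReal.mul_ne_top ENNReal.coe_ne_top (ENNReal.mul_ne_top enorm_ne_top
    (ENNReal.sum_ne_top.2 fun _ _ => enorm_ne_top))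

theorem exists_vector_ladyzhenskaya (Ω : PlanarDomain) : ∃ C : ℝ, 0 ≤ C ∧ ∀ v : VL2 Ω,
    VMemH10 v → l4Norm v ^ 2 ≤ C * (‖v‖ * gradNorm v) := by
  obtain ⟨C, hC⟩ := exists_ladyzhenskaya Ω
  have hcomp : ∀ u : L2 Ω, MemH10 u →
      (eLpNorm u 4 (vol Ω)).toReal ^ 2 ≤ C * (‖u‖ * ∑ j, ‖pd j u‖) := fun u hu => by
    have hsq : eLpNorm u 4 (vol Ω) ^ (2 : ℝ) ≤ C * (‖u‖ₑ * ∑ j, ‖pd j u‖ₑ) := by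
      rw [← ENNReal.le_rpow_inv_iff two_pos, ← one_div]
      exact hC u hu
    have hfour := ENNReal.coe_toNNReal hu.memLp_four.2.ne
    rw [ENNReal.rpow_two, ← hfour] at hsq
    simp only [enorm_eq_nnnorm] at hsq
    rw [← ENNReal.coe_toNNReal_eq_toReal]
    exact_mod_cast hsq
  refine ⟨8 * C, by positivity, fun v hv => ?_⟩
  calc l4Norm v ^ 2 ≤ 2 * ∑ i, (eLpNorm (v i) 4 (vol Ω)).toReal ^ 2 := by
        simpa [l4Norm] using sq_sum_le_card_mul_sum_sq (s := Finset.univ)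
          (f := fun i => (eLpNorm (v i) 4 (vol Ω)).toReal)
    _ ≤ 2 * ∑ i, C * (‖v i‖ * ∑ j, ‖pd j (v i)‖) := by
        gcongr with i
        exact hcomp _ (hv i)
    _ ≤ 2 * ∑ _i : Fin 2, C * (‖v‖ * ∑ _j : Fin 2, gradNorm v) := by
        gcongr with i _ j
        · exact PiLp.norm_apply_le v i
        · exact norm_pd_le_gradNorm v i j
    _ = 8 * C * (‖v‖ * gradNorm v) := by
        simp only [Finset.sum_const, Finset.card_univ, Fintype.card_fin, nsmul_eq_mul,
          Nat.cast_ofNat]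
        ring

theorem integrable_conv {v φ : VL2 Ω} (hv : VMemH10 v) (hφ : VMemH10 φ) (g : L2 Ω) (i j : Fin 2) :
    Integrable (fun x => v j x * g x * φ i x) (vol Ω) :=
  integrable_mul_mul (hv j).memLp_four (Lp.memLp g) (hφ i).memLp_four

theorem abs_conv_le {v φ : VL2 Ω} (hv : VMemH10 v) (w : VL2 Ω) (hφ : VMemH10 φ) :
    |conv v w φ| ≤ l4Norm v * gradNorm w * l4Norm φ := by
  calc |conv v w φ|
      ≤ ∑ i, ∑ j, |∫ x, v j x * pd j (w i) x * φ i x ∂(vol Ω)| :=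
        (Finset.abs_sum_le_sum_abs _ _).trans
          (Finset.sum_le_sum fun i _ => Finset.abs_sum_le_sum_abs _ _)
    _ ≤ ∑ i, ∑ j, (eLpNorm (v j) 4 (vol Ω)).toReal * gradNorm w *
          (eLpNorm (φ i) 4 (vol Ω)).toReal := by
        refine Finset.sum_le_sum fun i _ => Finset.sum_le_sum fun j _ => ?_
        refine (abs_integral_mul_mul_le (hv j).memLp_four (Lp.memLp (pd j (w i)))
          (hφ i).memLp_four).trans ?_
        gcongr
        exact (Lp.norm_def _).symm.trans_le (norm_pd_le_gradNorm w i j)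
    _ = l4Norm v * gradNorm w * l4Norm φ := by
        simp only [l4Norm, ← Finset.sum_mul, ← Finset.mul_sum]

theorem abs_b_le {v w φ : VL2 Ω} (hv : VMemH10 v) (hw : VMemH10 w) (hφ : VMemH10 φ) :
    |b v w φ| ≤ l4Norm v * (gradNorm w * l4Norm φ + gradNorm φ * l4Norm w) / 2 := by
  calc |b v w φ| ≤ |conv v w φ / 2| + |conv v φ w / 2| := abs_sub _ _
    _ = |conv v w φ| / 2 + |conv v φ w| / 2 := by simp only [abs_div, abs_two]
    _ ≤ l4Norm v * gradNorm w * l4Norm φ / 2 + l4Norm v * gradNorm φ * l4Norm w / 2 := by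
        gcongr
        · exact abs_conv_le hv w hφ
        · exact abs_conv_le hv φ hw
    _ = _ := by ring

theorem b_self (v w : VL2 Ω) : b v w w = 0 := sub_self _

theorem b_antisymm (v w φ : VL2 Ω) : b v w φ = -b v φ w := (neg_sub _ _).symm

theorem conv_add_left {v v' φ : VL2 Ω} (hv : VMemH10 v) (hv' : VMemH10 v') (w : VL2 Ω)
    (hφ : VMemH10 φ) : conv (v + v') w φ = conv v w φ + conv v' w φ := by
  simp only [conv, ← Finset.sum_add_distrib]
  congr! 2 with i _ j
  rw [← integral_add (integrable_conv hv hφ _ i j) (integrable_conv hv' hφ _ i j)]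
  refine integral_congr_ae ?_
  filter_upwards [Lp.coeFn_add (v j) (v' j)] with x hx
  rw [PiLp.add_apply, hx, Pi.add_apply, add_mul, add_mul]

theorem conv_add_middle {v w w' φ : VL2 Ω} (hv : VMemH10 v) (hw : VMemH10 w) (hw' : VMemH10 w')
    (hφ : VMemH10 φ) : conv v (w + w') φ = conv v w φ + conv v w' φ := by
  simp only [conv, ← Finset.sum_add_distrib]
  congr! 2 with i _ j
  rw [← integral_add (integrable_conv hv hφ _ i j) (integrable_conv hv hφ _ i j)]
  refine integral_congr_ae ?_
  filter_upwards [Lp.coeFn_add (pd j (w i)) (pd j (w' i))] with x hx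
  rw [PiLp.add_apply, (hw i).pd_add (hw' i), hx, Pi.add_apply, mul_add, add_mul]

theorem conv_add_right {v φ φ' : VL2 Ω} (hv : VMemH10 v) (w : VL2 Ω) (hφ : VMemH10 φ)
    (hφ' : VMemH10 φ') : conv v w (φ + φ') = conv v w φ + conv v w φ' := by
  simp only [conv, ← Finset.sum_add_distrib]
  congr! 2 with i _ j
  rw [← integral_add (integrable_conv hv hφ _ i j) (integrable_conv hv hφ' _ i j)]
  refine integral_congr_ae ?_
  filter_upwards [Lp.coeFn_add (φ i) (φ' i)] with x hx
  rw [PiLp.add_apply, hx, Pi.add_apply, mul_add]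

theorem b_add_left {v v' w φ : VL2 Ω} (hv : VMemH10 v) (hv' : VMemH10 v') (hw : VMemH10 w)
    (hφ : VMemH10 φ) : b (v + v') w φ = b v w φ + b v' w φ := by
  rw [b, conv_add_left hv hv' w hφ, conv_add_left hv hv' φ hw, b, b]
  ring

theorem b_add_middle {v w w' φ : VL2 Ω} (hv : VMemH10 v) (hw : VMemH10 w) (hw' : VMemH10 w')
    (hφ : VMemH10 φ) : b v (w + w') φ = b v w φ + b v w' φ := by
  rw [b, conv_add_middle hv hw hw' hφ, conv_add_right hv φ hw hw', b, b]
  ring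

theorem b_add_self_left {y z : VL2 Ω} (hy : VMemH10 y) (hz : VMemH10 z) :
    b (y + z) (y + z) y = -b (y + z) y z := by
  rw [b_add_middle (hy.add hz) hy hz hy, b_self, zero_add, b_antisymm]

theorem fineTermI_self {y z : VL2 Ω} (hy : VMemH10 y) (hz : VMemH10 z) :
    fineTermI y z z = b (y + z) y z := by
  rw [fineTermI, b_add_middle (hy.add hz) hy hz hz, b_self, add_zero]

theorem fineTermII_self (y z : VL2 Ω) : fineTermII y z z = b (y + z) y z := by
  rw [fineTermII, b_self, add_zero]

/-! ### The fine scale -/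

theorem norm_divergence_le (v : VL2 Ω) : ‖divergence v‖ ≤ 2 * gradNorm v :=
  (norm_sum_le _ _).trans ((Finset.sum_le_sum fun i _ => norm_pd_le_gradNorm v i i).trans_eq
    (by simp))

theorem VMemH10.integral_divergence {v : VL2 Ω} (hv : VMemH10 v) :
    ∫ x, divergence v x ∂(vol Ω) = 0 := by
  have hint : ∀ i, Integrable (pd i (v i)) (vol Ω) := fun i =>
    (Lp.memLp (pd i (v i))).integrable (by norm_num)
  rw [divergence, Fin.sum_univ_two, integral_congr_ae (Lp.coeFn_add _ _)]
  simp only [Pi.add_apply]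
  rw [integral_add (hint 0) (hint 1), (hv 0).integral_pd, (hv 1).integral_pd, add_zero]

theorem VMemH10.inner_const_divergence {v : VL2 Ω} (hv : VMemH10 v) (r : ℝ) :
    inner ℝ (Lp.const 2 (vol Ω) r) (divergence v) = 0 := by
  rw [← indicatorConstLp_univ, L2.inner_indicatorConstLp_eq_inner_setIntegral, setIntegral_univ,
    hv.integral_divergence, inner_zero_right]

theorem StokesRegular.exists_solution (hΩ : StokesRegular Ω) : ∃ C : ℝ, 0 ≤ C ∧
    ∀ g : VL2 Ω, ∃ (v : VL2 Ω) (q : L2 Ω), MemJ1 v ∧ VMemH2 v ∧ MemH1 q ∧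
      (∀ w : VL2 Ω, VMemH10 w → a v w - inner ℝ q (divergence w) = inner ℝ g w) ∧
      normH2 v ≤ C * ‖g‖ ∧ normH1 q ≤ C * ‖g‖ := by
  obtain ⟨C, hC⟩ := hΩ
  refine ⟨|C|, abs_nonneg C, fun g => ?_⟩
  obtain ⟨v, q, hv, hweak, hv2, hq, hle⟩ := hC g
  have hle' : normH2 v + normH1 q ≤ |C| * ‖g‖ := hle.trans (by gcongr; exact le_abs_self C)
  have hv2_nonneg : 0 ≤ normH2 v := Real.sqrt_nonneg _
  have hq_nonneg : 0 ≤ normH1 q := Real.sqrt_nonneg _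
  exact ⟨v, q, hv, hv2, hq, hweak, by linarith, by linarith⟩

namespace FEPair

theorem vMemH10_of_mem_J (S : FEPair Ω) {v : VL2 Ω} (hv : v ∈ S.J) : VMemH10 v :=
  S.velocity_mem v hv.1

theorem inner_eq_zero_of_mem_fineComplement {S SH : FEPair Ω} {z φ : VL2 Ω}
    (hz : z ∈ S.fineComplement SH) (hφ : φ ∈ SH.J) : inner ℝ z φ = 0 := by
  obtain ⟨w, -, rfl⟩ := hz
  exact SH.J.starProjection_inner_eq_zero w φ hφ

namespace Approximates

variable {S : FEPair Ω} {h K₀ K₅ : ℝ}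

theorem exists_norm_sub_const_le (hS : S.Approximates h K₀ K₅) (hh : 0 ≤ h) (hK₀ : 0 ≤ K₀)
    {q : L2 Ω} (hq : MemH1 q) : ∃ qh ∈ S.pressure, ∃ r : ℝ,
      ‖q - qh - Lp.const 2 (vol Ω) r‖ ≤ K₀ * h * normH1 q := by
  obtain ⟨qh, hqh, r, hr⟩ := hS.pressure_approx q hq
  refine ⟨qh, hqh, r, ?_⟩
  have hae : (q - qh - Lp.const 2 (vol Ω) r : L2 Ω) =ᵐ[vol Ω] fun x => q x - qh x - r := by
    filter_upwards [Lp.coeFn_sub (q - qh) (Lp.const 2 (vol Ω) r), Lp.coeFn_sub q qh,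
      Lp.coeFn_const 2 (vol Ω) r] with x hx hqx hrx
    rw [hx, Pi.sub_apply, hqx, hrx]
    rfl
  rw [Lp.norm_def, eLpNorm_congr_ae hae]
  refine ENNReal.toReal_le_of_le_ofReal ?_ hr
  exact mul_nonneg (mul_nonneg hK₀ hh) (Real.sqrt_nonneg _)

theorem abs_inner_divergence_le (hS : S.Approximates h K₀ K₅) (hh : 0 ≤ h) (hK₀ : 0 ≤ K₀)
    {q : L2 Ω} (hq : MemH1 q) {z : VL2 Ω} (hz : z ∈ S.J) :
    |inner ℝ q (divergence z)| ≤ K₀ * h * normH1 q * (2 * gradNorm z) := by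
  obtain ⟨qh, hqh, r, hr⟩ := hS.exists_norm_sub_const_le hh hK₀ hq
  calc |inner ℝ q (divergence z)|
      = |inner ℝ (q - qh - Lp.const 2 (vol Ω) r) (divergence z)| := by
        rw [inner_sub_left, inner_sub_left, (S.vMemH10_of_mem_J hz).inner_const_divergence,
          hz.2 qh hqh, sub_zero, sub_zero]
    _ ≤ ‖q - qh - Lp.const 2 (vol Ω) r‖ * ‖divergence z‖ := abs_real_inner_le_norm _ _
    _ ≤ _ := mul_le_mul hr (norm_divergence_le z) (norm_nonneg _) ((norm_nonneg _).trans hr)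

theorem inner_le_of_orthogonal (hS : S.Approximates h K₀ K₅) (hh : 0 ≤ h) {z v : VL2 Ω}
    (hz : ∀ φ ∈ S.J, inner ℝ z φ = 0) (hv : MemJ1 v) (hv2 : VMemH2 v) :
    inner ℝ z v ≤ ‖z‖ * (K₅ * h ^ 2 * normH2 v) := by
  obtain ⟨vh, hvh, hle⟩ := hS.divfree_approx v hv hv2
  calc inner ℝ z v = inner ℝ z (v - vh) := by rw [inner_sub_right, hz vh hvh, sub_zero]
    _ ≤ ‖z‖ * ‖v - vh‖ := real_inner_le_norm _ _
    _ ≤ ‖z‖ * (K₅ * h ^ 2 * normH2 v) := by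
        gcongr
        exact (le_add_of_nonneg_right (mul_nonneg hh (gradNorm_nonneg _))).trans hle

end Approximates

end FEPair

/-- Duality: test the Stokes problem with right-hand side `z` against `z`. As `z` is orthogonal to
the coarse space, its Stokes velocity `v` is of order `H` in the energy norm. -/
theorem StokesRegular.exists_fine_poincare (hΩ : StokesRegular Ω) {K₀ K₅ : ℝ} (hK₀ : 0 ≤ K₀)
    (hK₅ : 0 ≤ K₅) : ∃ C : ℝ, 0 ≤ C ∧ ∀ (S SH : FEPair Ω) (h H : ℝ), 0 ≤ h → h ≤ H →
      S.Approximates h K₀ K₅ → SH.Approximates H K₀ K₅ →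
      ∀ z ∈ S.J, (∀ φ ∈ SH.J, inner ℝ z φ = 0) → ‖z‖ ≤ C * H * gradNorm z := by
  obtain ⟨C, hC, hsol⟩ := hΩ.exists_solution
  refine ⟨√(K₅ * C) + 2 * K₀ * C, by positivity, fun S SH h H hh hhH hS hSH z hz horth => ?_⟩
  obtain ⟨v, q, hv, hv2, hq, hweak, hvle, hqle⟩ := hsol z
  have hH : 0 ≤ H := hh.trans hhH
  have hgz := gradNorm_nonneg z
  have hq_nonneg : 0 ≤ normH1 q := Real.sqrt_nonneg _
  have hgv : gradNorm v ≤ √(K₅ * C) * H * ‖z‖ := by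
    refine le_of_sq_le_sq ?_ (by positivity)
    calc gradNorm v ^ 2 = inner ℝ z v := by
          rw [← a_self, ← hweak v hv.1, hv.2, inner_zero_right, sub_zero]
      _ ≤ ‖z‖ * (K₅ * H ^ 2 * normH2 v) := hSH.inner_le_of_orthogonal hH horth hv hv2
      _ ≤ ‖z‖ * (K₅ * H ^ 2 * (C * ‖z‖)) := by gcongr
      _ = (√(K₅ * C) * H * ‖z‖) ^ 2 := by
          rw [mul_pow, mul_pow, Real.sq_sqrt (by positivity)]
          ring
  have hdual : ‖z‖ * ‖z‖ ≤ ‖z‖ * ((√(K₅ * C) + 2 * K₀ * C) * H * gradNorm z) :=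
    calc ‖z‖ * ‖z‖ = a v z - inner ℝ q (divergence z) := by
          rw [hweak z (S.vMemH10_of_mem_J hz), real_inner_self_eq_norm_mul_norm]
      _ ≤ |a v z| + |inner ℝ q (divergence z)| :=
          (le_abs_self _).trans (abs_sub _ _)
      _ ≤ gradNorm v * gradNorm z + K₀ * h * normH1 q * (2 * gradNorm z) :=
          add_le_add (abs_a_le v z) (hS.abs_inner_divergence_le hh hK₀ hq hz)
      _ ≤ √(K₅ * C) * H * ‖z‖ * gradNorm z + K₀ * H * (C * ‖z‖) * (2 * gradNorm z) := by gcongr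
      _ = _ := by ring
  rcases (norm_nonneg z).eq_or_lt with hz0 | hz0
  · rw [← hz0]
    positivity
  · exact le_of_mul_le_mul_left hdual hz0

/-- What the absorption argument uses of a coarse velocity `y` and a fine velocity `z` at the mesh
parameter `H`: the inverse inequality for `y`, the Poincaré inequality with constant of order `H`
for `z`, and the Ladyzhenskaya inequality for both. One constant `Λ` serves for all of them. -/
structure ScalePair (Λ H : ℝ) (y z : VL2 Ω) : Prop where
  coarse_mem : VMemH10 y
  fine_mem : VMemH10 z
  inverse : gradNorm y ≤ Λ * H⁻¹ * ‖y‖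
  poincare : ‖z‖ ≤ Λ * H * gradNorm z
  ladyzhenskaya_coarse : l4Norm y ^ 2 ≤ Λ * (‖y‖ * gradNorm y)
  ladyzhenskaya_fine : l4Norm z ^ 2 ≤ Λ * (‖z‖ * gradNorm z)

namespace ScalePair

variable {μ Λ H R : ℝ} {y z : VL2 Ω}

theorem l4Norm_coarse_sq_le (hyz : ScalePair Λ H y z) (hΛ : 0 ≤ Λ) :
    l4Norm y ^ 2 ≤ Λ ^ 2 * H⁻¹ * ‖y‖ ^ 2 :=
  calc l4Norm y ^ 2 ≤ Λ * (‖y‖ * gradNorm y) := hyz.ladyzhenskaya_coarse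
    _ ≤ Λ * (‖y‖ * (Λ * H⁻¹ * ‖y‖)) := by gcongr; exact hyz.inverse
    _ = _ := by ring

theorem l4Norm_fine_sq_le (hyz : ScalePair Λ H y z) (hΛ : 0 ≤ Λ) :
    l4Norm z ^ 2 ≤ Λ ^ 2 * H * gradNorm z ^ 2 := by
  have hg := gradNorm_nonneg z
  calc l4Norm z ^ 2 ≤ Λ * (‖z‖ * gradNorm z) := hyz.ladyzhenskaya_fine
    _ ≤ Λ * (Λ * H * gradNorm z * gradNorm z) := by gcongr; exact hyz.poincare
    _ = _ := by ring

theorem l4Norm_mul_l4Norm_le (hyz : ScalePair Λ H y z) (hΛ : 0 ≤ Λ) (hH : 0 < H) :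
    l4Norm y * l4Norm z ≤ Λ ^ 2 * (‖y‖ * gradNorm z) := by
  have hg := gradNorm_nonneg z
  refine le_of_sq_le_sq ?_ (by positivity)
  calc (l4Norm y * l4Norm z) ^ 2 = l4Norm y ^ 2 * l4Norm z ^ 2 := mul_pow _ _ _
    _ ≤ Λ ^ 2 * H⁻¹ * ‖y‖ ^ 2 * (Λ ^ 2 * H * gradNorm z ^ 2) :=
        mul_le_mul (hyz.l4Norm_coarse_sq_le hΛ) (hyz.l4Norm_fine_sq_le hΛ) (sq_nonneg _)
          (by positivity)
    _ = _ := by field_simp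

theorem abs_b_coarse_le (hyz : ScalePair Λ H y z) (hΛ : 0 ≤ Λ) (hH : 0 < H) :
    |b y y z| ≤ (Λ ^ 3 + Λ ^ 2) / 2 * H⁻¹ * ‖y‖ ^ 2 * gradNorm z := by
  have hg := gradNorm_nonneg z
  have hpq : 0 ≤ l4Norm y * l4Norm z := mul_nonneg (l4Norm_nonneg y) (l4Norm_nonneg z)
  calc |b y y z| ≤ l4Norm y * (gradNorm y * l4Norm z + gradNorm z * l4Norm y) / 2 :=
        abs_b_le hyz.coarse_mem hyz.coarse_mem hyz.fine_mem
    _ = (gradNorm y * (l4Norm y * l4Norm z) + gradNorm z * l4Norm y ^ 2) / 2 := by ring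
    _ ≤ (Λ * H⁻¹ * ‖y‖ * (Λ ^ 2 * (‖y‖ * gradNorm z))
          + gradNorm z * (Λ ^ 2 * H⁻¹ * ‖y‖ ^ 2)) / 2 := by
        gcongr (?_ * ?_ + gradNorm z * ?_) / 2
        exacts [hyz.inverse, hyz.l4Norm_mul_l4Norm_le hΛ hH, hyz.l4Norm_coarse_sq_le hΛ]
    _ = _ := by ring

theorem abs_b_fine_le (hyz : ScalePair Λ H y z) (hΛ : 0 ≤ Λ) (hH : 0 < H) :
    |b z y z| ≤ (Λ ^ 3 + Λ ^ 2) / 2 * ‖y‖ * gradNorm z ^ 2 := by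
  have hg := gradNorm_nonneg z
  calc |b z y z| ≤ l4Norm z * (gradNorm y * l4Norm z + gradNorm z * l4Norm y) / 2 :=
        abs_b_le hyz.fine_mem hyz.coarse_mem hyz.fine_mem
    _ = (gradNorm y * l4Norm z ^ 2 + gradNorm z * (l4Norm y * l4Norm z)) / 2 := by ring
    _ ≤ (Λ * H⁻¹ * ‖y‖ * (Λ ^ 2 * H * gradNorm z ^ 2)
          + gradNorm z * (Λ ^ 2 * (‖y‖ * gradNorm z))) / 2 := by
        gcongr (?_ * ?_ + gradNorm z * ?_) / 2
        exacts [hyz.inverse, hyz.l4Norm_fine_sq_le hΛ, hyz.l4Norm_mul_l4Norm_le hΛ hH]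
    _ = _ := by field_simp

/-- The nonlinear term contributes at most `(Λ³ + Λ²) / 2 * ‖y‖ * ‖∇z‖² ≤ μ / 2 * ‖∇z‖²`, which the
dissipation absorbs, and terms that are linear in `‖∇z‖`. -/
theorem gradNorm_le (hyz : ScalePair Λ H y z) (hμ : 0 ≤ μ) (hΛ : 0 ≤ Λ) (hH : 0 < H)
    (hR : 0 ≤ R) (hsmall : (Λ ^ 3 + Λ ^ 2) * ‖y‖ ≤ μ)
    (htest : μ * a (y + z) z + b (y + z) y z ≤ R * gradNorm z) :
    μ / 2 * gradNorm z ≤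
      R + μ * (Λ * H⁻¹ * ‖y‖) + (Λ ^ 3 + Λ ^ 2) / 2 * H⁻¹ * ‖y‖ ^ 2 := by
  rcases (gradNorm_nonneg z).eq_or_lt with hg | hg
  · rw [← hg, mul_zero]
    positivity
  have ha : -(Λ * H⁻¹ * ‖y‖ * gradNorm z) ≤ a y z := by
    refine neg_le_of_abs_le ((abs_a_le y z).trans ?_)
    gcongr
    exact hyz.inverse
  have hsum_a : a (y + z) z = a y z + gradNorm z ^ 2 := by
    rw [← inner_grad, hyz.coarse_mem.grad_add hyz.fine_mem, inner_add_left, inner_grad,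
      inner_grad, a_self]
  rw [hsum_a, b_add_left hyz.coarse_mem hyz.fine_mem hyz.coarse_mem hyz.fine_mem] at htest
  have hcoarse := neg_le_of_abs_le (hyz.abs_b_coarse_le hΛ hH)
  have hfine := neg_le_of_abs_le (hyz.abs_b_fine_le hΛ hH)
  have habsorb : (Λ ^ 3 + Λ ^ 2) * ‖y‖ * gradNorm z ^ 2 ≤ μ * gradNorm z ^ 2 := by gcongr
  refine le_of_mul_le_mul_left ?_ hg
  linarith [mul_le_mul_of_nonneg_left ha hμ]

theorem norm_fine_le (hyz : ScalePair Λ H y z) (hμ : 0 < μ) (hΛ : 0 ≤ Λ) (hH : 0 < H)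
    (hH1 : H ≤ 1) (hR : 0 ≤ R) (hsmall : (Λ ^ 3 + Λ ^ 2) * ‖y‖ ≤ μ)
    (htest : μ * a (y + z) z + b (y + z) y z ≤ R * gradNorm z) :
    ‖z‖ ≤ Λ * (2 * R / μ + (2 * Λ + 1) * ‖y‖) := by
  have hscaled : μ / 2 * (H * gradNorm z) ≤ μ / 2 * (2 * R / μ + (2 * Λ + 1) * ‖y‖) :=
    calc μ / 2 * (H * gradNorm z) = H * (μ / 2 * gradNorm z) := by ring
      _ ≤ H * (R + μ * (Λ * H⁻¹ * ‖y‖) + (Λ ^ 3 + Λ ^ 2) / 2 * H⁻¹ * ‖y‖ ^ 2) := by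
          gcongr
          exact hyz.gradNorm_le hμ.le hΛ hH hR hsmall htest
      _ = H * R + μ * Λ * ‖y‖ + (Λ ^ 3 + Λ ^ 2) * ‖y‖ * ‖y‖ / 2 := by field_simp
      _ ≤ 1 * R + μ * Λ * ‖y‖ + μ * ‖y‖ / 2 := by gcongr
      _ = _ := by field_simp; ring
  calc ‖z‖ ≤ Λ * (H * gradNorm z) := hyz.poincare.trans_eq (mul_assoc _ _ _)
    _ ≤ _ := by
        gcongr
        exact le_of_mul_le_mul_left hscaled (by positivity)

end ScalePair

theorem FEPair.fineComplement_le {S SH : FEPair Ω} (hJ : SH.J ≤ S.J) :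
    S.fineComplement SH ≤ S.J := by
  rintro _ ⟨w, hw, rfl⟩
  exact S.J.sub_mem hw (hJ (SH.J.starProjection_apply_mem w))

theorem StokesRegular.exists_scalePair (hΩ : StokesRegular Ω) {K₀ K₅ : ℝ} (hK₀ : 0 ≤ K₀)
    (hK₅ : 0 ≤ K₅) : ∃ Λ : ℝ, 0 < Λ ∧ ∀ (S SH : FEPair Ω) (h H : ℝ), 0 ≤ h → 0 < H → h ≤ H →
      S.Approximates h K₀ K₅ → SH.Approximates H K₀ K₅ → SH.J ≤ S.J →
      ∀ y ∈ SH.J, ∀ z ∈ S.fineComplement SH, ScalePair Λ H y z := by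
  obtain ⟨CF, hCF, hF⟩ := hΩ.exists_fine_poincare hK₀ hK₅
  obtain ⟨CL, hCL, hL⟩ := exists_vector_ladyzhenskaya Ω
  refine ⟨K₀ + CF + CL + 1, by positivity,
    fun S SH h H hh hH hhH hS hSH hJ y hy z hz => ?_⟩
  have hzJ := FEPair.fineComplement_le hJ hz
  have hlady : ∀ v : VL2 Ω, VMemH10 v →
      l4Norm v ^ 2 ≤ (K₀ + CF + CL + 1) * (‖v‖ * gradNorm v) := fun v hv =>
    (hL v hv).trans (mul_le_mul_of_nonneg_right (by linarith)
      (mul_nonneg (norm_nonneg v) (gradNorm_nonneg v)))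
  refine ⟨SH.vMemH10_of_mem_J hy, S.vMemH10_of_mem_J hzJ, (hSH.inverse y hy.1).trans ?_,
    (hF S SH h H hh hhH hS hSH z hzJ fun φ => FEPair.inner_eq_zero_of_mem_fineComplement hz).trans
      ?_, hlady y (SH.vMemH10_of_mem_J hy), hlady z (S.vMemH10_of_mem_J hzJ)⟩
  · gcongr
    linarith
  · have hg := gradNorm_nonneg z
    gcongr
    linarith

/-! ### A priori estimates for the schemes -/

theorem inner_le_mul_norm_grad {M C : ℝ} {g v : VL2 Ω} (hg : ‖g‖ ≤ M)
    (hv : ‖v‖ ≤ C * gradNorm v) : inner ℝ g v ≤ M * C * ‖grad v‖ :=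
  calc inner ℝ g v ≤ ‖g‖ * ‖v‖ := real_inner_le_norm g v
    _ ≤ M * (C * gradNorm v) := mul_le_mul hg hv (norm_nonneg v) ((norm_nonneg g).trans hg)
    _ = M * C * ‖grad v‖ := by rw [norm_grad, mul_assoc]

namespace IsGalerkin

variable {S : FEPair Ω} {μ γ δ α M C t₀ : ℝ} {f : ℝ → VL2 Ω} {u₀ : VL2 Ω} {uh : ℝ → VL2 Ω}

theorem energyInequality (hG : IsGalerkin S μ γ δ f u₀ t₀ uh)
    (hP : ∀ v : VL2 Ω, VMemH10 v → ‖v‖ ≤ C * gradNorm v) (hf : ∀ t ∈ Ioo 0 t₀, ‖f t‖ ≤ M) :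
    EnergyInequality μ γ δ (M * C) (fun t => grad (uh t)) uh 0 t₀ := by
  have hgrad : MemLp (fun t => grad (uh t)) 2 (volume.restrict (Ioc 0 t₀)) := by
    obtain ⟨R, hR⟩ := isCompact_Icc.exists_bound_of_continuousOn hG.continuousOn
    refine S.memLp_grad (MemLp.of_bound ((hG.continuousOn.mono Ioc_subset_Icc_self
      ).aestronglyMeasurable measurableSet_Ioc) R ?_) ?_
    · filter_upwards [ae_restrict_mem measurableSet_Ioc] with t ht
      exact hR t (Ioc_subset_Icc_self ht)
    · filter_upwards [ae_restrict_mem measurableSet_Ioc] with t ht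
      exact (hG.mem t (Ioc_subset_Icc_self ht)).1
  refine ⟨hgrad, hG.continuousOn, fun t ht => ?_⟩
  have hmem := hG.mem t (Ioo_subset_Icc_self ht)
  obtain ⟨ut, hut, heq⟩ := hG.equation t (Ioo_subset_Ioc_self ht)
  refine ⟨ut, hut.hasDerivAt (Icc_mem_nhds ht.1 ht.2), ?_⟩
  have hint : IntervalIntegrable (fun s => grad (uh s)) volume 0 t := by
    rw [intervalIntegrable_iff_integrableOn_Ioc_of_le ht.1.le]
    exact (hgrad.mono_measure (Measure.restrict_mono (Ioc_subset_Ioc_right ht.2.le) le_rfl)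
      ).integrable (by norm_num)
  have htest := heq (uh t) hmem
  rw [b_self, neg_zero, zero_add, a_self, integral_kernel_mul_a γ δ hint] at htest
  rw [norm_grad, htest, ← norm_grad]
  exact inner_le_mul_norm_grad (hf t ht) (hP _ (S.vMemH10_of_mem_J hmem))

theorem norm_sq_le (hG : IsGalerkin S μ γ δ f u₀ t₀ uh) (hμ : 0 < μ) (hγ : 0 ≤ γ) (hα₀ : 0 < α)
    (hα : α ≤ δ) (hαC : 2 * α * C ^ 2 ≤ μ) (ht₀ : 0 ≤ t₀)
    (hP : ∀ v : VL2 Ω, VMemH10 v → ‖v‖ ≤ C * gradNorm v) (hf : ∀ t ∈ Ioo 0 t₀, ‖f t‖ ≤ M) :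
    ‖uh t₀‖ ^ 2 ≤ ‖u₀‖ ^ 2 + (M * C) ^ 2 / μ / (2 * α) := by
  have henergy := (hG.energyInequality hP hf).norm_sq_le hμ hγ hα₀ hα hαC ht₀ fun t ht =>
    (hP _ (S.vMemH10_of_mem_J (hG.mem t (Ioo_subset_Icc_self ht)))).trans_eq
      (by rw [norm_grad])
  refine henergy.trans ?_
  gcongr
  rw [hG.init]
  exact S.J.norm_starProjection_apply_le u₀

end IsGalerkin

theorem Icc_subset_timeSet {t₀ t : ℝ} {T : EReal} (ht : t ∈ timeSet t₀ T) :
    Icc t₀ t ⊆ timeSet t₀ T := fun _ hs => ⟨hs.1, (EReal.coe_le_coe_iff.2 hs.2).trans ht.2⟩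

namespace IsNLG

variable {N : VL2 Ω → VL2 Ω → VL2 Ω → ℝ} {S SH : FEPair Ω} {μ γ δ α Λ H M C R B t₀ t : ℝ}
  {f : ℝ → VL2 Ω} {u₀ : VL2 Ω} {T : EReal} {uh y z : ℝ → VL2 Ω}

theorem fine_mem_J (hS : IsNLG N S SH μ γ δ f t₀ T uh y z) (hJ : SH.J ≤ S.J)
    (ht : t ∈ timeSet t₀ T) (ht₀ : t₀ < t) : z t ∈ S.J :=
  FEPair.fineComplement_le hJ (hS.mem_fine t ht ht₀)

theorem add_mem_J (hS : IsNLG N S SH μ γ δ f t₀ T uh y z) (hJ : SH.J ≤ S.J)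
    (ht : t ∈ timeSet t₀ T) (ht₀ : t₀ < t) : y t + z t ∈ S.J :=
  S.J.add_mem (hJ (hS.mem_coarse t ht)) (hS.fine_mem_J hJ ht ht₀)

theorem norm_coarse_le (hS : IsNLG N S SH μ γ δ f t₀ T uh y z) (ht : t ∈ timeSet t₀ T)
    (ht₀ : t₀ < t) : ‖y t‖ ≤ ‖y t + z t‖ := by
  have horth : inner ℝ (y t) (z t) = 0 := by
    rw [real_inner_comm]
    exact FEPair.inner_eq_zero_of_mem_fineComplement (hS.mem_fine t ht ht₀) (hS.mem_coarse t ht)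
  refine le_of_sq_le_sq ?_ (norm_nonneg _)
  rw [norm_add_sq_real, horth, mul_zero, add_zero]
  exact le_add_of_nonneg_right (sq_nonneg _)

theorem memLp_grad (hS : IsNLG N S SH μ γ δ f t₀ T uh y z) (hJ : SH.J ≤ S.J)
    (ht : t ∈ timeSet t₀ T) :
    MemLp (fun s => grad (y s + z s)) 2 (volume.restrict (Ioc t₀ t)) := by
  refine S.memLp_grad (hS.square_integrable t ht) ?_
  filter_upwards [ae_restrict_mem measurableSet_Ioc] with s hs
  exact (hS.add_mem_J hJ (Icc_subset_timeSet ht (Ioc_subset_Icc_self hs)) hs.1).1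

theorem intervalIntegrable_grad (hS : IsNLG N S SH μ γ δ f t₀ T uh y z) (hJ : SH.J ≤ S.J)
    (ht : t ∈ timeSet t₀ T) : IntervalIntegrable (fun s => grad (y s + z s)) volume t₀ t := by
  rw [intervalIntegrable_iff_integrableOn_Ioc_of_le ht.1]
  exact (hS.memLp_grad hJ ht).integrable (by norm_num)

/-- The trilinear terms cancel when the coarse equation is tested with `y` and the fine one with
`z`. -/
theorem exists_deriv_le (hS : IsNLG N S SH μ γ δ f t₀ T uh y z) (hJ : SH.J ≤ S.J)
    (hN : ∀ v w : VL2 Ω, VMemH10 v → VMemH10 w → N v w w = b (v + w) v w)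
    (hP : ∀ v : VL2 Ω, VMemH10 v → ‖v‖ ≤ C * gradNorm v)
    (ht : t ∈ timeSet t₀ T) (ht₀ : t₀ < t) (hf : ‖f t‖ ≤ M) :
    ∃ y', HasDerivWithinAt y y' (timeSet t₀ T) t ∧
      inner ℝ y' (y t) + μ * ‖grad (y t + z t)‖ ^ 2
        + inner ℝ (memory γ δ t₀ (fun s => grad (y s + z s)) t) (grad (y t + z t))
      ≤ M * C * ‖grad (y t + z t)‖ := by
  obtain ⟨y', hy', hcoarse⟩ := hS.coarse_equation t ht ht₀
  refine ⟨y', hy', ?_⟩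
  have hy := S.vMemH10_of_mem_J (hJ (hS.mem_coarse t ht))
  have hz := S.vMemH10_of_mem_J (hS.fine_mem_J hJ ht ht₀)
  have hint := hS.intervalIntegrable_grad hJ ht
  have hcoarse_test := hcoarse (y t) (hS.mem_coarse t ht)
  have hfine_test := hS.fine_equation t ht ht₀ (z t) (hS.mem_fine t ht ht₀)
  rw [integral_kernel_mul_a γ δ hint, b_add_self_left hy hz] at hcoarse_test
  rw [integral_kernel_mul_a γ δ hint, hN _ _ hy hz] at hfine_test
  have hforce := inner_le_mul_norm_grad hf (hP _ (hy.add hz))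
  have hnorm : ‖grad (y t + z t)‖ ^ 2 = a (y t + z t) (y t) + a (y t + z t) (z t) := by
    rw [← real_inner_self_eq_norm_sq, ← inner_grad, ← inner_grad, ← inner_add_right,
      ← hy.grad_add hz]
  have hmemory : inner ℝ (memory γ δ t₀ (fun s => grad (y s + z s)) t) (grad (y t + z t))
      = inner ℝ (memory γ δ t₀ (fun s => grad (y s + z s)) t) (grad (y t))
        + inner ℝ (memory γ δ t₀ (fun s => grad (y s + z s)) t) (grad (z t)) := by
    rw [hy.grad_add hz, inner_add_right]
  rw [hnorm, hmemory]
  rw [inner_add_right] at hforce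
  linarith

theorem energyInequality (hS : IsNLG N S SH μ γ δ f t₀ T uh y z) (hJ : SH.J ≤ S.J)
    (hN : ∀ v w : VL2 Ω, VMemH10 v → VMemH10 w → N v w w = b (v + w) v w)
    (hP : ∀ v : VL2 Ω, VMemH10 v → ‖v‖ ≤ C * gradNorm v)
    (hf : ∀ s ∈ Ioo t₀ t, ‖f s‖ ≤ M) (ht : t ∈ timeSet t₀ T) :
    EnergyInequality μ γ δ (M * C) (fun s => grad (y s + z s)) y t₀ t := by
  have hsub := Icc_subset_timeSet ht
  refine ⟨hS.memLp_grad hJ ht, hS.continuousOn.mono hsub, fun s hs => ?_⟩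
  obtain ⟨y', hy', hle⟩ :=
    hS.exists_deriv_le hJ hN hP (hsub (Ioo_subset_Icc_self hs)) hs.1 (hf s hs)
  exact ⟨y', hy'.hasDerivAt (mem_of_superset (Icc_mem_nhds hs.1 hs.2) hsub), hle⟩

theorem norm_sq_le (hS : IsNLG N S SH μ γ δ f t₀ T uh y z) (hJ : SH.J ≤ S.J)
    (hN : ∀ v w : VL2 Ω, VMemH10 v → VMemH10 w → N v w w = b (v + w) v w) (hμ : 0 < μ)
    (hγ : 0 ≤ γ) (hα₀ : 0 < α) (hα : α ≤ δ) (hαC : 2 * α * C ^ 2 ≤ μ)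
    (hP : ∀ v : VL2 Ω, VMemH10 v → ‖v‖ ≤ C * gradNorm v)
    (hf : ∀ s ∈ Ioo t₀ t, ‖f s‖ ≤ M) (ht : t ∈ timeSet t₀ T) :
    ‖y t‖ ^ 2 ≤ ‖uh t₀‖ ^ 2 + (M * C) ^ 2 / μ / (2 * α) := by
  have henergy := (hS.energyInequality hJ hN hP hf ht).norm_sq_le hμ hγ hα₀ hα hαC ht.1
    fun s hs => by
      have hs' := Icc_subset_timeSet ht (Ioo_subset_Icc_self hs)
      rw [norm_grad]
      exact (hS.norm_coarse_le hs' hs.1).trans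
        (hP _ (S.vMemH10_of_mem_J (hS.add_mem_J hJ hs' hs.1)))
  refine henergy.trans ?_
  gcongr
  rw [hS.init]
  exact SH.J.norm_starProjection_apply_le _

theorem norm_sq_le_of_isGalerkin (hS : IsNLG N S SH μ γ δ f t₀ T uh y z) (hJ : SH.J ≤ S.J)
    (hN : ∀ v w : VL2 Ω, VMemH10 v → VMemH10 w → N v w w = b (v + w) v w)
    (hG : IsGalerkin S μ γ δ f u₀ t₀ uh) (hμ : 0 < μ) (hγ : 0 ≤ γ) (hα₀ : 0 < α) (hα : α ≤ δ)
    (hαC : 2 * α * C ^ 2 ≤ μ) (hP : ∀ v : VL2 Ω, VMemH10 v → ‖v‖ ≤ C * gradNorm v)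
    (ht₀ : 0 ≤ t₀) (hf : ∀ s ∈ Ioc 0 t, ‖f s‖ ≤ M) (ht : t ∈ timeSet t₀ T) :
    ‖y t‖ ^ 2 ≤ ‖u₀‖ ^ 2 + 2 * ((M * C) ^ 2 / μ / (2 * α)) := by
  have hGalerkin := hG.norm_sq_le hμ hγ hα₀ hα hαC ht₀ hP
    fun s hs => hf s ⟨hs.1, hs.2.le.trans ht.1⟩
  have hNLG := hS.norm_sq_le hJ hN hμ hγ hα₀ hα hαC hP
    (fun s hs => hf s ⟨ht₀.trans_lt hs.1, hs.2.le⟩) ht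
  linarith

theorem intervalIntegrable_exp_mul_gradNorm_sq (hS : IsNLG N S SH μ γ δ f t₀ T uh y z)
    (hJ : SH.J ≤ S.J) (ht : t ∈ timeSet t₀ T) :
    IntervalIntegrable (fun s => Real.exp (2 * α * s) * gradNorm (y s + z s) ^ 2)
      volume t₀ t := by
  simpa only [norm_grad] using
    intervalIntegrable_exp_mul_norm_sq ht.1 (hS.memLp_grad hJ ht) (2 * α)

theorem exp_mul_integral_gradNorm_sq_le (hS : IsNLG N S SH μ γ δ f t₀ T uh y z)
    (hJ : SH.J ≤ S.J) (hN : ∀ v w : VL2 Ω, VMemH10 v → VMemH10 w → N v w w = b (v + w) v w)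
    (hμ : 0 < μ) (hγ : 0 ≤ γ) (hα₀ : 0 < α) (hα : α ≤ δ)
    (hP : ∀ v : VL2 Ω, VMemH10 v → ‖v‖ ≤ C * gradNorm v) (hf : ∀ s ∈ Ioo t₀ t, ‖f s‖ ≤ M)
    (ht : t ∈ timeSet t₀ T) (hB : ∀ s ∈ Icc t₀ t, ‖y s‖ ^ 2 ≤ B) :
    Real.exp (-2 * α * t) * ∫ s in t₀..t, Real.exp (2 * α * s) * gradNorm (y s + z s) ^ 2
      ≤ (B + (M * C) ^ 2 / μ / (2 * α)) / μ := by
  simpa only [norm_grad] using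
    (hS.energyInequality hJ hN hP hf ht).exp_mul_integral_le hμ hγ hα₀ hα ht.1 hB

theorem fine_test_le (hS : IsNLG N S SH μ γ δ f t₀ T uh y z) (hJ : SH.J ≤ S.J)
    (hN : ∀ v w : VL2 Ω, VMemH10 v → VMemH10 w → N v w w = b (v + w) v w)
    (hP : ∀ v : VL2 Ω, VMemH10 v → ‖v‖ ≤ C * gradNorm v)
    (ht : t ∈ timeSet t₀ T) (ht₀ : t₀ < t) (hf : ‖f t‖ ≤ M)
    (hR : ‖memory γ δ t₀ (fun s => grad (y s + z s)) t‖ ≤ R) :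
    μ * a (y t + z t) (z t) + b (y t + z t) (y t) (z t) ≤ (M * C + R) * gradNorm (z t) := by
  have hy := S.vMemH10_of_mem_J (hJ (hS.mem_coarse t ht))
  have hz := S.vMemH10_of_mem_J (hS.fine_mem_J hJ ht ht₀)
  have hfine_test := hS.fine_equation t ht ht₀ (z t) (hS.mem_fine t ht ht₀)
  rw [integral_kernel_mul_a γ δ (hS.intervalIntegrable_grad hJ ht), hN _ _ hy hz] at hfine_test
  have hforce := inner_le_mul_norm_grad hf (hP _ hz)
  have hmemory := neg_le_of_abs_le ((abs_real_inner_le_norm _ (grad (z t))).trans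
    (mul_le_mul_of_nonneg_right hR (norm_nonneg _)))
  rw [norm_grad] at hforce hmemory
  linarith

theorem norm_fine_le (hS : IsNLG N S SH μ γ δ f t₀ T uh y z) (hJ : SH.J ≤ S.J)
    (hN : ∀ v w : VL2 Ω, VMemH10 v → VMemH10 w → N v w w = b (v + w) v w)
    (hμ : 0 < μ) (hγ : 0 ≤ γ) (hα : α < δ) (hC : 0 ≤ C) (hΛ : 0 ≤ Λ) (hH : 0 < H) (hH1 : H ≤ 1)
    (hP : ∀ v : VL2 Ω, VMemH10 v → ‖v‖ ≤ C * gradNorm v)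
    (ht : t ∈ timeSet t₀ T) (ht₀ : t₀ < t) (hf : ‖f t‖ ≤ M)
    (hR : Real.exp (-2 * α * t) * ∫ s in t₀..t, Real.exp (2 * α * s) * gradNorm (y s + z s) ^ 2
      ≤ R) (hyz : ScalePair Λ H (y t) (z t)) (hsmall : (Λ ^ 3 + Λ ^ 2) * ‖y t‖ ≤ μ) :
    ‖z t‖ ≤ Λ * (2 * (M * C + γ / 2 * (1 / (2 * (δ - α)) + R)) / μ + (2 * Λ + 1) * ‖y t‖) := by
  have hmemory : ‖memory γ δ t₀ (fun s => grad (y s + z s)) t‖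
      ≤ γ / 2 * (1 / (2 * (δ - α)) + R) := by
    refine norm_memory_le hγ hα ht.1
      (intervalIntegrable_exp_mul_norm_sq ht.1 (hS.memLp_grad hJ ht) (2 * α)) ?_
    simpa only [norm_grad] using hR
  have hM : 0 ≤ M := (norm_nonneg _).trans hf
  have hforce_memory : 0 ≤ M * C + γ / 2 * (1 / (2 * (δ - α)) + R) :=
    add_nonneg (mul_nonneg hM hC) ((norm_nonneg _).trans hmemory)
  exact hyz.norm_fine_le hμ hΛ hH hH1 hforce_memory hsmall
    (hS.fine_test_le hJ hN hP ht ht₀ hf hmemory)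

end IsNLG

theorem exists_isNLG_of_fineTermI_or_fineTermII {S SH : FEPair Ω} {μ γ δ t₀ : ℝ}
    {f : ℝ → VL2 Ω} {T : EReal} {uh y z : ℝ → VL2 Ω}
    (hS : IsNLG fineTermI S SH μ γ δ f t₀ T uh y z ∨
      IsNLG fineTermII S SH μ γ δ f t₀ T uh y z) :
    ∃ N : VL2 Ω → VL2 Ω → VL2 Ω → ℝ,
      (∀ v w, VMemH10 v → VMemH10 w → N v w w = b (v + w) v w) ∧
        IsNLG N S SH μ γ δ f t₀ T uh y z :=
  hS.elim (fun hI => ⟨_, fun _ _ => fineTermI_self, hI⟩)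
    fun hII => ⟨_, fun v w _ _ => fineTermII_self v w, hII⟩

/-! ### Uniform constants -/

theorem exists_absorbable_rate {μ δ C : ℝ} (hμ : 0 < μ) (hδ : 0 < δ) (hC : 0 < C) :
    ∃ α : ℝ, 0 < α ∧ α ≤ δ ∧ 2 * α * C ^ 2 ≤ μ := by
  refine ⟨min δ (μ / (2 * C ^ 2)), lt_min hδ (by positivity), min_le_left _ _, ?_⟩
  calc 2 * min δ (μ / (2 * C ^ 2)) * C ^ 2 ≤ 2 * (μ / (2 * C ^ 2)) * C ^ 2 := by
        gcongr; exact min_le_right _ _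
    _ = μ := by field_simp

theorem exists_logarithmic_threshold {μ ε H₀ κ : ℝ} (hμ : 0 < μ) (hε : 0 < ε) (hH₀ : 0 < H₀)
    (hH₀1 : H₀ < 1) (hκ : 0 < κ) : ∃ c : ℝ, 0 < c ∧ ∀ H L η : ℝ, 0 < H → H ≤ H₀ →
      κ * √|Real.log H| ≤ L → 0 < μ - c * L ^ 2 * η ^ 2 → η ≤ ε := by
  have hlog₀ : 0 < |Real.log H₀| := abs_pos.2 (Real.log_neg hH₀ hH₀1).ne
  refine ⟨μ / (κ ^ 2 * |Real.log H₀| * ε ^ 2), by positivity, fun H L η hH hHH₀ hL hη => ?_⟩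
  have hlog : |Real.log H₀| ≤ |Real.log H| := by
    rw [abs_of_neg (Real.log_neg hH₀ hH₀1), abs_of_neg (Real.log_neg hH (hHH₀.trans_lt hH₀1))]
    exact neg_le_neg (Real.log_le_log hH hHH₀)
  have hL_sq : κ ^ 2 * |Real.log H₀| ≤ L ^ 2 :=
    calc κ ^ 2 * |Real.log H₀| ≤ κ ^ 2 * |Real.log H| := by gcongr
      _ = (κ * √|Real.log H|) ^ 2 := by rw [mul_pow, Real.sq_sqrt (abs_nonneg _)]
      _ ≤ L ^ 2 := by gcongr
  refine le_of_sq_le_sq ?_ hε.le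
  have hlt : μ / (κ ^ 2 * |Real.log H₀| * ε ^ 2) * (κ ^ 2 * |Real.log H₀|) * η ^ 2 < μ := by
    refine lt_of_le_of_lt ?_ (sub_pos.1 hη)
    gcongr
  have hratio : μ / (κ ^ 2 * |Real.log H₀| * ε ^ 2) * (κ ^ 2 * |Real.log H₀|) * η ^ 2
      = μ * (η ^ 2 / ε ^ 2) := by field_simp
  rw [hratio, mul_lt_iff_lt_one_right hμ, div_lt_one (by positivity)] at hlt
  exact hlt.le

end Oldroyd

theorem lemma4p1_general {Ω : PlanarDomain} (hΩ : StokesRegular Ω) {μ γ δ α M₀ K₀ K₅ : ℝ}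
    (hμ : 0 < μ) (hγ : 0 ≤ γ) (hα : 0 < α) (hαδ : α < δ) (hM₀ : 0 ≤ M₀) (hK₀ : 0 ≤ K₀)
    (hK₅ : 0 ≤ K₅) :
    ∃ K : ℝ, 0 < K ∧ ∀ H₀ κ : ℝ, 0 < H₀ → H₀ < 1 → 0 < κ → ∃ c : ℝ, 0 < c ∧
      ∀ (N : VL2 Ω → VL2 Ω → VL2 Ω → ℝ) (t₀ : ℝ) (T : EReal) (f : ℝ → VL2 Ω) (u₀ : VL2 Ω)
        (h H : ℝ) (S SH : FEPair Ω) (uh y z : ℝ → VL2 Ω),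
        (∀ v w : VL2 Ω, VMemH10 v → VMemH10 w → N v w w = b (v + w) v w) →
        0 ≤ t₀ → VMemH10 u₀ → gradNorm u₀ ≤ M₀ →
        (∀ t ∈ timeSet 0 T, 0 < t → ‖f t‖ ≤ M₀) →
        0 < h → h ≤ H → S.Approximates h K₀ K₅ → SH.Approximates H K₀ K₅ →
        SH.J ≤ S.J → IsGalerkin S μ γ δ f u₀ t₀ uh → IsNLG N S SH μ γ δ f t₀ T uh y z →
        ∀ t ∈ timeSet t₀ T, t₀ < t →
          (IntervalIntegrable (fun s => Real.exp (2 * α * s) * gradNorm (y s + z s) ^ 2)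
              volume t₀ t ∧
            ‖y t‖ ^ 2 + Real.exp (-2 * α * t) *
              ∫ s in t₀..t, Real.exp (2 * α * s) * gradNorm (y s + z s) ^ 2 ≤ K) ∧
          ∀ L : ℝ, H ≤ H₀ → κ * √|Real.log H| ≤ L → 0 < μ - c * L ^ 2 * ‖y t‖ ^ 2 →
            ‖z t‖ ≤ K := by
  obtain ⟨C, hC, hP⟩ := exists_vector_poincare Ω
  obtain ⟨Λ, hΛ, hscale⟩ := hΩ.exists_scalePair hK₀ hK₅
  obtain ⟨α₀, hα₀, hα₀δ, hα₀C⟩ := exists_absorbable_rate hμ (hα.trans hαδ) hC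
  have : 0 < δ - α := sub_pos.2 hαδ
  set B := (C * M₀) ^ 2 + 2 * ((M₀ * C) ^ 2 / μ / (2 * α₀)) with hB
  set R := (B + (M₀ * C) ^ 2 / μ / (2 * α)) / μ
  set ε := μ / (Λ ^ 3 + Λ ^ 2) with hε
  set Kz := Λ * (2 * (M₀ * C + γ / 2 * (1 / (2 * (δ - α)) + R)) / μ + (2 * Λ + 1) * ε) with hKz
  have hB₀ : 0 ≤ B := by positivity
  have hR₀ : 0 ≤ R := by positivity
  have hε₀ : 0 < ε := by positivity
  have hKz₀ : 0 < Kz := by positivity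
  refine ⟨B + R + Kz, by positivity, fun H₀ κ hH₀ hH₀1 hκ => ?_⟩
  obtain ⟨c, hc, hthreshold⟩ := exists_logarithmic_threshold hμ hε₀ hH₀ hH₀1 hκ
  refine ⟨c, hc, fun N t₀ T f u₀ h H S SH uh y z hN ht₀ hu₀ hu₀M hf hh hhH hS hSH hJ hG hNLG
    t ht htt => ?_⟩
  have hft : ∀ s ∈ Ioc 0 t, ‖f s‖ ≤ M₀ := fun s hs =>
    hf s ⟨hs.1.le, (EReal.coe_le_coe_iff.2 hs.2).trans ht.2⟩ hs.1
  have hu₀B : ‖u₀‖ ≤ C * M₀ := (hP u₀ hu₀).trans (by gcongr)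
  have hyB : ∀ s ∈ Icc t₀ t, ‖y s‖ ^ 2 ≤ B := fun s hs =>
    (hNLG.norm_sq_le_of_isGalerkin hJ hN hG hμ hγ hα₀ hα₀δ hα₀C hP ht₀
      (fun r hr => hft r ⟨hr.1, hr.2.trans hs.2⟩) (Icc_subset_timeSet ht hs)).trans
        (by rw [hB]; gcongr)
  have hgrad := hNLG.exp_mul_integral_gradNorm_sq_le hJ hN hμ hγ hα hαδ.le hP
    (fun s hs => hft s ⟨ht₀.trans_lt hs.1, hs.2.le⟩) ht hyB
  refine ⟨⟨hNLG.intervalIntegrable_exp_mul_gradNorm_sq hJ ht, ?_⟩, fun L hHH₀ hL hy => ?_⟩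
  · linarith [hyB t ⟨ht.1, le_rfl⟩]
  have hH : 0 < H := hh.trans_le hhH
  have hyε : ‖y t‖ ≤ ε := hthreshold H L _ hH hHH₀ hL hy
  have hfine := hNLG.norm_fine_le hJ hN hμ hγ hαδ hC.le hΛ.le hH (hHH₀.trans hH₀1.le) hP ht htt
    (hft t ⟨ht₀.trans_lt htt, le_rfl⟩) hgrad
    (hscale S SH h H hh.le hH hhH hS hSH hJ _ (hNLG.mem_coarse t ht) _ (hNLG.mem_fine t ht htt))
    (by rwa [hε, le_div_iff₀' (by positivity)] at hyε)
  have hzK : ‖z t‖ ≤ Kz := hfine.trans (by rw [hKz]; gcongr)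
  linarith

theorem lemma4p1 (Ω : PlanarDomain) (hΩ : StokesRegular Ω)
    (μ γ δ ev₁ α M₀ K₀ K₅ : ℝ) (hμ : 0 < μ) (hγ : 0 < γ) (hδ : 0 < δ)
    (hev : IsLeast {ev : ℝ | IsStokesEigenvalue Ω ev} ev₁)
    (hα : 0 < α) (hα' : α < min (μ * ev₁) δ)
    (hM₀ : 0 < M₀) (hK₀ : 0 < K₀) (hK₅ : 0 < K₅) :
    ∃ K : ℝ, 0 < K ∧
      ∀ H₀ κ₁ κ₂ : ℝ, 0 < H₀ → H₀ < 1 → 0 < κ₁ → 0 < κ₂ →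
      ∃ c : ℝ, 0 < c ∧
        ∀ (t₀ : ℝ) (T : EReal) (f : ℝ → VL2 Ω) (u₀ : VL2 Ω) (h H : ℝ) (S SH : FEPair Ω)
          (uh y z : ℝ → VL2 Ω),
          0 < t₀ → (t₀ : EReal) < T →
          MemJ1 u₀ → gradNorm u₀ ≤ M₀ → BoundedForce f M₀ T →
          0 < h → h < H → H < 1 →
          S.Approximates h K₀ K₅ → SH.Approximates H K₀ K₅ →
          S.J = SH.J ⊔ S.fineComplement SH →
          IsGalerkin S μ γ δ f u₀ t₀ uh →
          (IsNLG fineTermI S SH μ γ δ f t₀ T uh y z ∨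
            IsNLG fineTermII S SH μ γ δ f t₀ T uh y z) →
          ∀ t ∈ timeSet t₀ T, t₀ < t →
            (IntervalIntegrable (fun s => Real.exp (2 * α * s) * gradNorm (y s + z s) ^ 2)
                MeasureTheory.volume t₀ t ∧
              ‖y t‖ ^ 2 + Real.exp (-2 * α * t) *
                ∫ s in t₀..t, Real.exp (2 * α * s) * gradNorm (y s + z s) ^ 2 ≤ K) ∧
            ∀ LH : ℝ, H ≤ H₀ → κ₁ * √|Real.log H| ≤ LH → LH ≤ κ₂ * √|Real.log h| →
              0 < μ - c * LH ^ 2 * ‖y t‖ ^ 2 → ‖z t‖ ≤ K := by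
  obtain ⟨K, hK, hbounds⟩ := lemma4p1_general hΩ hμ hγ.le hα (lt_min_iff.1 hα').2 hM₀.le hK₀.le
    hK₅.le
  refine ⟨K, hK, fun H₀ κ₁ _ hH₀ hH₀1 hκ₁ _ => ?_⟩
  obtain ⟨c, hc, hbounds⟩ := hbounds H₀ κ₁ hH₀ hH₀1 hκ₁
  refine ⟨c, hc, fun t₀ T f u₀ h H S SH uh y z ht₀ _ hu₀ hu₀M hf hh hhH _ hS hSH hJ hG hNLG
    t ht htt => ?_⟩
  obtain ⟨N, hN, hNLG⟩ := exists_isNLG_of_fineTermI_or_fineTermII hNLG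
  obtain ⟨henergy, hfine⟩ := hbounds N t₀ T f u₀ h H S SH uh y z hN ht₀.le hu₀.1 hu₀M hf.1 hh
    hhH.le hS hSH (le_sup_left.trans_eq hJ.symm) hG hNLG t ht htt
  exact ⟨henergy, fun LH hHH₀ hLH _ => hfine LH hHH₀ hLH⟩
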